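/- \textbf{Proposition (Coarse robust mean estimation).} \emph{Notation.} For $p\ge 1$, let $W_p$ be the $p$-Wasserstein distance on $\mathbb R^d$ with the Euclidean norm, let $\|\cdot\|_{TV}$ be half of the total variation norm, and for $\varepsilon\ge 0$ put $W_p^\varepsilon(\mu,\nu)=\inf\{W_p(\mu',\nu):\mu'\in\mathcal P(\mathbb R^d),\ \|\mu'-\mu\|_{TV}\le\varepsilon\}$. For a probability measure $\nu$ on $\mathbb R$ with distribution function $F_\nu$ and quantile function $F_\nu^{-1}(t)=\inf\{x:F_\nu(x)\ge t\}$, the $\gamma$-trimmed mean ($0\le\gamma<1/2$) is $m_\gamma(\nu)=\mathbb E[F_\nu^{-1}(U)]$ with $U$ uniform on $[\gamma,1-\gamma]$. For points $x_1,\dots,x_n\in\mathbb R^d$ with empirical measure $\hat\mu=\frac1n\sum_j\delta_{x_j}$, the coordinate-wise $\frac13$-trimmed mean is the vector with $i$-th coordinate $m_{1/3}((\mathbf e_i^\top)_\#\hat\mu)$. \emph{Setting.} Let $n,d\ge 1$, let $\mathcal Z\subseteq\mathbb R^d$ be closed and non-empty, $p\in[1,\infty)$, $\rho_0\ge 0$,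 $0\le\varepsilon\le 1/3$, and let $\mathcal G$ be a class of Borel probability measures on $\mathcal Z$ with finite $p$-th and second moments and covariance matrix $\Sigma_\mu\preceq I_d$. Let $Z_1,\dots,Z_n$ be i.i.d. with law $\mu\in\mathcal G$, with empirical measure $\hat\mu_n$, and let $\tilde Z_1,\dots,\tilde Z_n$ be any random points of $\mathcal Z$ on the same probability space (depending arbitrarily on the $Z_j$ and on additional randomness) whose empirical measure $\tilde\mu_n$ satisfies $W_p^\varepsilon(\tilde\mu_n,\hat\mu_n)\le\rho_0$ almost surely. Let $z_0$ be the coordinate-wise $\frac13$-trimmed mean of $\tilde Z_1,\dots,\tilde Z_n$. \emph{Claim.} (1) There are absolute constants $c,C>0$ such that, whenever $n\ge c\log d$, $$\Pr\bigl(\|z_0-\mathbb E_\mu[Z]\|\le C(\sqrt d+\rho_0)\bigr)\ge 0.99 .$$ (2) There is a single program for a unit-cost real random access machine (natural-number registers with addition, subtraction and comparison; arrays of real cells with indirect addressing, arithmetic and comparison; no rounding) which computes the coordinate-wise $\frac13$-trimmed mean of any $n\ge1$ points of $\mathbb R^d$, $d\ge1$, in at most $K\,nd\,(1+\log n)$ steps,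 $K$ an absolute constant. In particular, its running time is $\tilde O(d)$ when $n$ is polylogarithmic in $d$, for instance $n=\Theta(\log d)$: for all $A,a\in\mathbb N$ there are $K',k$ such that it takes at most $K'd(1+\log d)^k$ steps whenever $n\le A(1+\log d)^a$. -/

import Mathlib

open MeasureTheory ProbabilityTheory
open scoped ENNReal NNReal

noncomputable section

/-! ### Wasserstein, total variation and outlier-robust Wasserstein distances -/

namespace RobustMean

/-- The space `ℝ^d` with the Euclidean norm. -/
abbrev Space (d : ℕ) : Type := EuclideanSpace ℝ (Fin d)

/-- `μ` is a Borel probability measure on `𝒵` (viewed as a measure on `ℝ^d`) with finite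
`p`-th moment. -/
def finiteMoment {d : ℕ} (𝒵 : Set (Space d)) (p : ℝ) : Set (Measure (Space d)) :=
  {μ | IsProbabilityMeasure μ ∧ μ 𝒵ᶜ = 0 ∧ MemLp (fun z => z) (ENNReal.ofReal p) μ}

/-- The covariance matrix of a measure on `ℝ^d`. -/
def covMat {d : ℕ} (μ : Measure (Space d)) : Matrix (Fin d) (Fin d) ℝ :=
  Matrix.of fun i j => covariance (fun z => z i) (fun z => z j) μ

/-- The bounded covariance class: square-integrable laws on `𝒵` with covariance `⪯ I`. -/
def boundedCov {d : ℕ} (𝒵 : Set (Space d)) : Set (Measure (Space d)) :=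
  {μ | μ ∈ finiteMoment 𝒵 2 ∧ (1 - covMat μ).PosSemidef}

/-- `π` is a coupling of `μ` and `ν`. -/
def IsCoupling {d : ℕ} (π : Measure (Space d × Space d)) (μ ν : Measure (Space d)) : Prop :=
  π.map Prod.fst = μ ∧ π.map Prod.snd = ν

/-- The `p`-Wasserstein distance (with value `∞` allowed). -/
def wasserstein {d : ℕ} (p : ℝ) (μ ν : Measure (Space d)) : ℝ≥0∞ :=
  ⨅ (π : Measure (Space d × Space d)) (_ : IsCoupling π μ ν),
    (∫⁻ z, ‖z.1 - z.2‖ₑ ^ p ∂π) ^ (1 / p)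

/-- The total variation distance `‖μ - ν‖_TV = |μ - ν|(ℝ^d) / 2`. -/
def tvDist {d : ℕ} (μ ν : Measure (Space d)) [IsFiniteMeasure μ] [IsFiniteMeasure ν] : ℝ :=
  (1 / 2) * (μ.toSignedMeasure - ν.toSignedMeasure).totalVariation.real Set.univ

/-- The `ε`-outlier-robust `p`-Wasserstein distance: the infimum of `W_p(μ', ν)` over probability
measures `μ'` on `ℝ^d` with `‖μ' - μ‖_TV ≤ ε`. -/
def robustWasserstein {d : ℕ} (p ε : ℝ) (μ ν : Measure (Space d)) [IsFiniteMeasure μ] : ℝ≥0∞ :=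
  ⨅ (μ' : ProbabilityMeasure (Space d)) (_ : tvDist (μ' : Measure (Space d)) μ ≤ ε),
    wasserstein p (μ' : Measure (Space d)) ν

/-- The empirical measure of `n` points. -/
def empirical {n d : ℕ} (x : Fin n → Space d) : Measure (Space d) :=
  ((n : ℝ≥0)⁻¹) • ∑ j, Measure.dirac (x j)

instance instIsFiniteMeasureEmpirical {n d : ℕ} (x : Fin n → Space d) :
    IsFiniteMeasure (empirical x) := by
  unfold empirical
  infer_instance

/-! ### The corruption model -/

/-- The finite-sample corruption model. `Z` are i.i.d. samples of `μ ∈ 𝒢`, and `Z'` is the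
observed dataset: any random dataset in `𝒵`, on the same probability space as `Z` and depending on
`Z` in an arbitrary way, with `W_p^ε` distance at most `ρ₀` between the two empirical measures. -/
structure CorruptedSample {Ω : Type*} [MeasurableSpace Ω] {n d : ℕ} (P : Measure Ω)
    (𝒵 : Set (Space d)) (𝒢 : Set (Measure (Space d))) (p ε ρ₀ : ℝ) (μ : Measure (Space d))
    (Z Z' : Fin n → Ω → Space d) : Prop where
  isProbabilityMeasure : IsProbabilityMeasure P
  isClosed : IsClosed 𝒵
  nonempty : 𝒵.Nonempty
  one_le_p : 1 ≤ p
  eps_mem : ε ∈ Set.Icc (0 : ℝ) 0.49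
  radius_nonneg : 0 ≤ ρ₀
  class_subset : 𝒢 ⊆ finiteMoment 𝒵 p
  law_mem : μ ∈ 𝒢
  measurable_clean : ∀ j, Measurable (Z j)
  indep : iIndepFun Z P
  law : ∀ j, P.map (Z j) = μ
  measurable_corrupted : ∀ j, Measurable (Z' j)
  corrupted_mem : ∀ᵐ ω ∂P, ∀ j, Z' j ω ∈ 𝒵
  corruption : ∀ᵐ ω ∂P,
    robustWasserstein p ε (empirical fun j => Z' j ω) (empirical fun j => Z j ω)
      ≤ ENNReal.ofReal ρ₀

/-! ### The trimmed mean -/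

/-- The quantile function `F_ν⁻¹`, with `F_ν` the distribution function of `ν`. -/
def quantile (ν : Measure ℝ) (t : ℝ) : ℝ := sInf {x : ℝ | t ≤ cdf ν x}

/-- The `γ`-trimming of `ν`: the law of `F_ν⁻¹(U)` with `U` uniform on `[γ, 1 - γ]`. -/
def trimming (γ : ℝ) (ν : Measure ℝ) : Measure ℝ :=
  (ProbabilityTheory.cond volume (Set.Icc γ (1 - γ))).map (quantile ν)

/-- The `γ`-trimmed mean of `ν`. -/
def trimmedMean (γ : ℝ) (ν : Measure ℝ) : ℝ := ∫ x, x ∂(trimming γ ν)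

/-- The coordinate-wise `γ`-trimmed mean of a dataset in `ℝ^d`. -/
def coordTrimmedMean {n d : ℕ} (γ : ℝ) (x : Fin n → Space d) : Space d :=
  WithLp.toLp 2 fun i => trimmedMean γ ((empirical x).map fun z => z i)

end RobustMean

/-! ### A real random access machine

Programs are finite structured programs over natural-number registers (used for indices and
counters) and finitely many arrays of real cells, addressed indirectly. Every arithmetic operation,
comparison, memory access and control transfer has unit cost. The only real constants are the
natural numbers, and there is no rounding from reals to integers. -/

namespace RealRAM

/-- Index expressions: constants, registers, sum and truncated difference. -/
inductive IdxExpr : Type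
  | const : ℕ → IdxExpr
  | reg : ℕ → IdxExpr
  | add : IdxExpr → IdxExpr → IdxExpr
  | sub : IdxExpr → IdxExpr → IdxExpr

/-- Real expressions; `load k a` reads cell `a` of array `k`. -/
inductive RealExpr : Type
  | ofIdx : IdxExpr → RealExpr
  | load : ℕ → IdxExpr → RealExpr
  | add : RealExpr → RealExpr → RealExpr
  | sub : RealExpr → RealExpr → RealExpr
  | mul : RealExpr → RealExpr → RealExpr
  | div : RealExpr → RealExpr → RealExpr

/-- Tests. -/
inductive Test : Type
  | idxLe : IdxExpr → IdxExpr → Test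
  | realLe : RealExpr → RealExpr → Test
  | not : Test → Test
  | and : Test → Test → Test

/-- Programs. -/
inductive Prog : Type
  | skip : Prog
  | setReg : ℕ → IdxExpr → Prog
  | store : ℕ → IdxExpr → RealExpr → Prog
  | seq : Prog → Prog → Prog
  | ite : Test → Prog → Prog → Prog
  | while : Test → Prog → Prog

/-- A machine state: the registers and the arrays. -/
structure State : Type where
  reg : ℕ → ℕ
  mem : ℕ → ℕ → ℝ

/-- Value of an index expression. -/
def IdxExpr.val (s : State) : IdxExpr → ℕ
  | const k => k
  | reg r => s.reg r
  | add e f => e.val s + f.val s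
  | sub e f => e.val s - f.val s

/-- Cost of evaluating an index expression: its number of nodes. -/
def IdxExpr.cost : IdxExpr → ℕ
  | const _ => 1
  | reg _ => 1
  | add e f => e.cost + f.cost + 1
  | sub e f => e.cost + f.cost + 1

/-- Value of a real expression. -/
def RealExpr.val (s : State) : RealExpr → ℝ
  | ofIdx e => (e.val s : ℝ)
  | load k a => s.mem k (a.val s)
  | add e f => e.val s + f.val s
  | sub e f => e.val s - f.val s
  | mul e f => e.val s * f.val s
  | div e f => e.val s / f.val s

/-- Cost of evaluating a real expression: its number of nodes. -/
def RealExpr.cost : RealExpr → ℕ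
  | ofIdx e => e.cost + 1
  | load _ a => a.cost + 1
  | add e f => e.cost + f.cost + 1
  | sub e f => e.cost + f.cost + 1
  | mul e f => e.cost + f.cost + 1
  | div e f => e.cost + f.cost + 1

/-- Truth of a test. -/
def Test.holds (s : State) : Test → Prop
  | idxLe e f => e.val s ≤ f.val s
  | realLe e f => e.val s ≤ f.val s
  | not t => ¬ t.holds s
  | and t u => t.holds s ∧ u.holds s

/-- Cost of a test: its number of nodes. -/
def Test.cost : Test → ℕ
  | idxLe e f => e.cost + f.cost + 1
  | realLe e f => e.cost + f.cost + 1
  | not t => t.cost + 1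
  | and t u => t.cost + u.cost + 1

/-- `Run c s t s'`: started in state `s`, the program `c` halts in state `s'` after `t` steps. -/
inductive Run : Prog → State → ℕ → State → Prop
  | skip (s : State) : Run .skip s 1 s
  | setReg (s : State) (r : ℕ) (e : IdxExpr) :
      Run (.setReg r e) s (e.cost + 1) ⟨Function.update s.reg r (e.val s), s.mem⟩
  | store (s : State) (k : ℕ) (a : IdxExpr) (e : RealExpr) :
      Run (.store k a e) s (a.cost + e.cost + 1)
        ⟨s.reg, Function.update s.mem k (Function.update (s.mem k) (a.val s) (e.val s))⟩
  | seq {c₁ c₂ : Prog} {s s₁ s₂ : State} {t₁ t₂ : ℕ} :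
      Run c₁ s t₁ s₁ → Run c₂ s₁ t₂ s₂ → Run (.seq c₁ c₂) s (t₁ + t₂) s₂
  | iteTrue {b : Test} {c₁ c₂ : Prog} {s s' : State} {t : ℕ} :
      b.holds s → Run c₁ s t s' → Run (.ite b c₁ c₂) s (b.cost + t + 1) s'
  | iteFalse {b : Test} {c₁ c₂ : Prog} {s s' : State} {t : ℕ} :
      ¬ b.holds s → Run c₂ s t s' → Run (.ite b c₁ c₂) s (b.cost + t + 1) s'
  | whileTrue {b : Test} {c : Prog} {s s₁ s₂ : State} {t₁ t₂ : ℕ} :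
      b.holds s → Run c s t₁ s₁ → Run (.while b c) s₁ t₂ s₂ →
        Run (.while b c) s (b.cost + t₁ + t₂ + 1) s₂
  | whileFalse {b : Test} {c : Prog} {s : State} :
      ¬ b.holds s → Run (.while b c) s (b.cost + 1) s

/-- The initial state for a dataset of `n` points in `ℝ^d`: registers `0` and `1` hold `n` and `d`,
cell `j * d + i` of array `0` holds coordinate `i` of point `j`, and everything else is zero. -/
def initState {n d : ℕ} (x : Fin n → EuclideanSpace ℝ (Fin d)) : State where
  reg := fun r => if r = 0 then n else if r = 1 then d else 0
  mem := fun k a => if k = 0 then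
      (if h : a / d < n ∧ a % d < d then x ⟨a / d, h.1⟩ ⟨a % d, h.2⟩ else 0) else 0

/-- On the dataset `x`, the program `c` halts within `T` steps with the vector `z` in the first `d`
cells of array `1`. -/
def ComputesWithin {n d : ℕ} (c : Prog) (x : Fin n → EuclideanSpace ℝ (Fin d))
    (z : EuclideanSpace ℝ (Fin d)) (T : ℝ) : Prop :=
  ∃ (t : ℕ) (s' : State), Run c (initState x) t s' ∧ (t : ℝ) ≤ T ∧
    ∀ i : Fin d, s'.mem 1 (i : ℕ) = z i

end RealRAM

end

namespace RobustMean

/-! ### Total variation and quantiles -/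

/-! Statistical claim. If `ν` and `ν'` on the line differ by at most `1/3` on every event, the third
of the mass trimmed from each end of `ν` pays for the difference: each tail of the trimming of `ν`
is at most three times the same tail of `ν'` (`trimming_third_Ioi_le`, `trimming_third_Iio_le`).
Integrating tails, the trimmed mean of `ν` is within `3 E|X - m|`, `X ~ ν'`, of any centre `m`. In
`ℝ^d` the coordinate bounds combine without dimensional loss, since the vector of the `E|X_i - m_i|`
is the mean of a random vector of norm `‖X - m‖`.

Here `ν` comes from the corrupted sample and `ν'` from a measure close in `W_p` to the clean one. A
coupling bounds `E‖X - m‖` by the radius plus the clean average of `‖Z_j - m‖`. With `m` the true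
mean, this average has expectation at most `√d`, by the trace of the covariance, and Markov's
inequality finishes; no concentration is needed.

Algorithmic claim. The quantile function of an empirical measure is a step function through the
order statistics, so the trimmed mean is a combination of these with weights computable by integer
arithmetic (`trimmedMean_third_eq_sum`). Bottom-up merge sort on each column makes `⌈log₂ n⌉` linear
passes; `MergeInv` carries its correctness. -/

lemma measureReal_le_add_tvDist {d : ℕ} (μ ν : Measure (Space d)) [IsProbabilityMeasure μ]
    [IsProbabilityMeasure ν] {A : Set (Space d)} (hA : MeasurableSet A) :
    ν.real A ≤ μ.real A + tvDist μ ν := by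
  -- The difference takes opposite values on `A` and `Aᶜ`, so its total variation is at least twice
  -- its size on `A`. This cancels the factor `1/2`.
  have h1 := (μ.toSignedMeasure - ν.toSignedMeasure).norm_le_totalVariation A
  have h2 := (μ.toSignedMeasure - ν.toSignedMeasure).norm_le_totalVariation Aᶜ
  have h3 := measureReal_add_measureReal_compl
    (μ := (μ.toSignedMeasure - ν.toSignedMeasure).totalVariation) hA
  rw [Measure.toSignedMeasure_sub_apply hA, Real.norm_eq_abs] at h1
  rw [Measure.toSignedMeasure_sub_apply hA.compl, Real.norm_eq_abs, probReal_compl_eq_one_sub hA,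
    probReal_compl_eq_one_sub hA] at h2
  have h4 := neg_abs_le (μ.real A - ν.real A)
  have h5 := le_abs_self (1 - μ.real A - (1 - ν.real A))
  unfold tvDist
  linarith

/-- Right continuity of the distribution function makes the infimum attained. The bounds on `t` make
the set nonempty and bounded below, so `sInf` is a true infimum. -/
lemma quantile_le_iff (ν : Measure ℝ) {t : ℝ} (h0 : 0 < t) (h1 : t < 1) (x : ℝ) :
    quantile ν t ≤ x ↔ t ≤ cdf ν x := by
  have hne : {x : ℝ | t ≤ cdf ν x}.Nonempty :=
    (((tendsto_cdf_atTop ν).eventually (lt_mem_nhds h1)).exists).imp fun _ h => h.le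
  have hbdd : BddBelow {x : ℝ | t ≤ cdf ν x} := by
    obtain ⟨a, ha⟩ := ((tendsto_cdf_atBot ν).eventually (gt_mem_nhds h0)).exists
    refine ⟨a, fun y hy => ?_⟩
    by_contra! hya
    exact absurd (hy.trans (monotone_cdf ν hya.le)) (not_le.2 ha)
  refine ⟨fun h => ?_, fun h => csInf_le hbdd h⟩
  have hmem : ∀ y, x < y → t ≤ cdf ν y := fun y hy => by
    obtain ⟨z, hz, hzy⟩ := exists_lt_of_csInf_lt hne (lt_of_le_of_lt h hy)
    exact le_trans hz (monotone_cdf ν hzy.le)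
  have hcont : Filter.Tendsto (cdf ν) (nhdsWithin x (Set.Ioi x)) (nhds (cdf ν x)) :=
    ((cdf ν).right_continuous x).mono_left (nhdsWithin_mono _ Set.Ioi_subset_Ici_self)
  exact ge_of_tendsto hcont (Filter.eventually_of_mem self_mem_nhdsWithin hmem)

lemma monotoneOn_quantile (ν : Measure ℝ) {a b : ℝ} (ha : 0 < a) (hb : b < 1) :
    MonotoneOn (quantile ν) (Set.Icc a b) := by
  intro s hs t ht hst
  rw [quantile_le_iff ν (ha.trans_le hs.1) (hs.2.trans_lt hb)]
  exact hst.trans ((quantile_le_iff ν (ha.trans_le ht.1) (ht.2.trans_lt hb) _).1 le_rfl)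

lemma aemeasurable_quantile (ν : Measure ℝ) {γ : ℝ} (hγ : 0 < γ) :
    AEMeasurable (quantile ν) (ProbabilityTheory.cond volume (Set.Icc γ (1 - γ))) :=
  (aemeasurable_restrict_of_monotoneOn measurableSet_Icc
    (monotoneOn_quantile ν hγ (by linarith))).smul_measure _

/-! ### Tails of the trimming -/

lemma trimming_third_apply (ν : Measure ℝ) {A : Set ℝ} (hA : MeasurableSet A) :
    trimming (1 / 3) ν A = 3 * volume (Set.Icc (1 / 3 : ℝ) (2 / 3) ∩ quantile ν ⁻¹' A) := by
  rw [trimming, Measure.map_apply_of_aemeasurable (aemeasurable_quantile ν (by norm_num)) hA,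
    ProbabilityTheory.cond_apply measurableSet_Icc, Real.volume_Icc]
  congr 1
  · rw [show (1 - 1 / 3 - 1 / 3 : ℝ) = 3⁻¹ by norm_num, ENNReal.ofReal_inv_of_pos (by norm_num),
      inv_inv]
    simp
  · norm_num

instance isProbabilityMeasure_trimming_third (ν : Measure ℝ) :
    IsProbabilityMeasure (trimming (1 / 3) ν) := by
  constructor
  rw [trimming_third_apply ν MeasurableSet.univ, Set.preimage_univ, Set.inter_univ,
    Real.volume_Icc, show (2 / 3 - 1 / 3 : ℝ) = 3⁻¹ by norm_num,
    ENNReal.ofReal_inv_of_pos (by norm_num)]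
  simp [ENNReal.mul_inv_cancel]

section Tails

variable {ν ν' : Measure ℝ} [IsProbabilityMeasure ν] [IsProbabilityMeasure ν']

/-- The quantile exceeds `y` only at levels above `cdf ν y`. Below level `2/3` these have length at
most the positive part of `ν (Ioi y) - 1/3`, and the subtracted third absorbs the one in `h`. The
factor `3` normalizes the uniform law. -/
lemma trimming_third_Ioi_le (h : ∀ A, MeasurableSet A → ν.real A ≤ ν'.real A + 1 / 3) (y : ℝ) :
    trimming (1 / 3) ν (Set.Ioi y) ≤ 3 * ν' (Set.Ioi y) := by
  rw [trimming_third_apply ν measurableSet_Ioi]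
  refine mul_le_mul_right ?_ 3
  calc volume (Set.Icc (1 / 3 : ℝ) (2 / 3) ∩ quantile ν ⁻¹' Set.Ioi y)
      ≤ volume (Set.Icc (cdf ν y) (2 / 3)) := by
        refine measure_mono fun t ht => ⟨?_, ht.1.2⟩
        by_contra! hlt
        exact absurd ((quantile_le_iff ν (by linarith [ht.1.1]) (by linarith [ht.1.2]) y).2 hlt.le)
          (not_le.2 ht.2)
    _ ≤ ν' (Set.Ioi y) := by
        rw [Real.volume_Icc, ← ofReal_measureReal]
        refine ENNReal.ofReal_le_ofReal ?_
        have h1 := h _ (measurableSet_Ioi (a := y))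
        have h2 := probReal_compl_eq_one_sub (μ := ν) (measurableSet_Iic (a := y))
        rw [Set.compl_Iic, ← cdf_eq_real] at h2
        linarith

lemma trimming_third_Iio_le (h : ∀ A, MeasurableSet A → ν.real A ≤ ν'.real A + 1 / 3) (y : ℝ) :
    trimming (1 / 3) ν (Set.Iio y) ≤ 3 * ν' (Set.Iio y) := by
  rw [trimming_third_apply ν measurableSet_Iio]
  refine mul_le_mul_right ?_ 3
  calc volume (Set.Icc (1 / 3 : ℝ) (2 / 3) ∩ quantile ν ⁻¹' Set.Iio y)
      ≤ volume (Set.Icc (1 / 3) (ν.real (Set.Iio y))) := by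
        refine measure_mono fun t ht => ⟨ht.1.1, ?_⟩
        have h1 := (quantile_le_iff ν (by linarith [ht.1.1]) (by linarith [ht.1.2]) _).1
          (le_refl (quantile ν t))
        rw [cdf_eq_real] at h1
        exact h1.trans (measureReal_mono (Set.Iic_subset_Iio.2 ht.2))
    _ ≤ ν' (Set.Iio y) := by
        rw [Real.volume_Icc, ← ofReal_measureReal]
        refine ENNReal.ofReal_le_ofReal ?_
        linarith [h _ (measurableSet_Iio (a := y))]

lemma lintegral_trimming_third_le (h : ∀ A, MeasurableSet A → ν.real A ≤ ν'.real A + 1 / 3)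
    (m : ℝ) : ∫⁻ x, ‖x - m‖ₑ ∂(trimming (1 / 3) ν) ≤ 3 * ∫⁻ x, ‖x - m‖ₑ ∂ν' := by
  have layer : ∀ κ : Measure ℝ,
      ∫⁻ x, ‖x - m‖ₑ ∂κ = ∫⁻ s in Set.Ioi 0, κ {x | s < |x - m|} := fun κ => by
    rw [← lintegral_eq_lintegral_meas_lt κ (.of_forall fun x => abs_nonneg (x - m))
      (by fun_prop)]
    simp only [← Real.norm_eq_abs, ofReal_norm]
  have tail : ∀ s : ℝ, {x | s < |x - m|} = Set.Iio (m - s) ∪ Set.Ioi (m + s) := fun s => by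
    ext x
    simp only [Set.mem_ofPred_eq, lt_abs, Set.mem_union, Set.mem_Iio, Set.mem_Ioi]
    constructor <;> rintro (h | h) <;> [right; left; right; left] <;> linarith
  rw [layer, layer, ← lintegral_const_mul' _ _ (by simp)]
  refine setLIntegral_mono' measurableSet_Ioi fun s hs => ?_
  have hdisj : Disjoint (Set.Iio (m - s)) (Set.Ioi (m + s)) := by
    rw [Set.disjoint_left]
    intro x hx hx'
    simp only [Set.mem_Iio, Set.mem_Ioi] at hx hx' hs
    linarith
  rw [tail, measure_union hdisj measurableSet_Ioi, measure_union hdisj measurableSet_Ioi, mul_add]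
  exact add_le_add (trimming_third_Iio_le h _) (trimming_third_Ioi_le h _)

/-- Replacing at most a third of the mass moves the `1/3`-trimmed mean by a bounded multiple of
the first absolute moment. -/
lemma abs_trimmedMean_third_sub_le
    (h : ∀ A, MeasurableSet A → ν.real A ≤ ν'.real A + 1 / 3) (m : ℝ)
    (hint : Integrable (fun x => |x - m|) ν') :
    |trimmedMean (1 / 3) ν - m| ≤ 3 * ∫ x, |x - m| ∂ν' := by
  have hle := lintegral_trimming_third_le h m
  have hfin : ∫⁻ x, ‖x - m‖ₑ ∂ν' ≠ ∞ := by
    have := hint.2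
    simp only [HasFiniteIntegral, ← Real.norm_eq_abs, enorm_norm] at this
    exact this.ne
  have hT : Integrable (fun x => x - m) (trimming (1 / 3) ν) :=
    ⟨by fun_prop, hle.trans_lt (ENNReal.mul_lt_top (by simp) hfin.lt_top)⟩
  have hid : Integrable (fun x : ℝ => x) (trimming (1 / 3) ν) := by
    refine (hT.add (integrable_const m)).congr (.of_forall fun x => ?_)
    simp
  have heq : trimmedMean (1 / 3) ν - m = ∫ x, (x - m) ∂(trimming (1 / 3) ν) := by
    rw [integral_sub hid (integrable_const m)]
    simp only [integral_const, probReal_univ, smul_eq_mul, one_mul, trimmedMean]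
  have h1 : ENNReal.ofReal |trimmedMean (1 / 3) ν - m|
      ≤ 3 * ENNReal.ofReal (∫ x, |x - m| ∂ν') := by
    rw [ofReal_integral_eq_lintegral_ofReal hint (.of_forall fun x => abs_nonneg _), heq]
    simp only [← Real.norm_eq_abs, ofReal_norm]
    exact (enorm_integral_le_lintegral_enorm _).trans hle
  have h2 : (0 : ℝ) ≤ ∫ x, |x - m| ∂ν' := integral_nonneg fun _ => abs_nonneg _
  rw [show (3 : ℝ≥0∞) = ENNReal.ofReal 3 by simp, ← ENNReal.ofReal_mul (by norm_num)] at h1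
  exact (ENNReal.ofReal_le_ofReal_iff (by positivity)).1 h1

end Tails

/-! ### The coordinate-wise trimmed mean of corrupted data -/

instance isProbabilityMeasure_empirical {n d : ℕ} [NeZero n] (x : Fin n → Space d) :
    IsProbabilityMeasure (empirical x) := by
  constructor
  have hn : ((n : ℝ≥0)) ≠ 0 := by exact_mod_cast NeZero.ne n
  simp only [empirical, Measure.smul_apply, Measure.coe_finsetSum, Finset.sum_apply, measure_univ,
    Finset.sum_const, Finset.card_univ, Fintype.card_fin, ENNReal.smul_def, smul_eq_mul,
    nsmul_eq_mul, mul_one]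
  rw [ENNReal.coe_inv hn, ENNReal.coe_natCast]
  exact ENNReal.inv_mul_cancel (by exact_mod_cast NeZero.ne n) (by simp)

lemma lintegral_empirical {n d : ℕ} (x : Fin n → Space d) {f : Space d → ℝ≥0∞}
    (hf : Measurable f) :
    ∫⁻ z, f z ∂(empirical x) = ((n : ℝ≥0)⁻¹ : ℝ≥0) * ∑ j, f (x j) := by
  rw [empirical, lintegral_smul_measure, lintegral_finsetSum_measure]
  simp [lintegral_dirac' _ hf, ENNReal.smul_def]

/-- Taking absolute values coordinate by coordinate preserves the Euclidean norm. The
one-dimensional bounds are thus the coordinates of the integral of `v`, and the triangle inequality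
for that integral avoids a factor `√d`. -/
lemma norm_coordTrimmedMean_sub_le {n d : ℕ} [NeZero n] (x : Fin n → Space d)
    (μ' : Measure (Space d)) [IsProbabilityMeasure μ'] (htv : tvDist μ' (empirical x) ≤ 1 / 3)
    (m : Space d) (hint : Integrable (fun z => ‖z - m‖) μ') :
    ‖coordTrimmedMean (1 / 3) x - m‖ ≤ 3 * ∫ z, ‖z - m‖ ∂μ' := by
  set v : Space d → Space d := fun z => WithLp.toLp 2 fun i => |z i - m i| with hv
  have hvn : ∀ z, ‖v z‖ = ‖z - m‖ := fun z => by
    simp [EuclideanSpace.norm_eq, hv]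
  have hvm : Measurable v := by
    simp only [hv]
    fun_prop
  have hvi : Integrable v μ' := (integrable_norm_iff hvm.aestronglyMeasurable).1 (by simpa [hvn])
  have hcoord : ∀ i : Fin d, Measurable fun z : Space d => z i := fun i => by fun_prop
  have hi : ∀ i, Integrable (fun z : Space d => |z i - m i|) μ' := fun i =>
    (EuclideanSpace.proj (𝕜 := ℝ) i).integrable_comp hvi
  have hvI : ∀ i, (∫ z, v z ∂μ') i = ∫ z, |z i - m i| ∂μ' := fun i =>
    ((EuclideanSpace.proj (𝕜 := ℝ) i).integral_comp_comm hvi).symm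
  have hle : ∀ i, |(coordTrimmedMean (1 / 3) x - m) i| ≤ |((3 : ℝ) • ∫ z, v z ∂μ') i| := by
    intro i
    have : IsProbabilityMeasure ((empirical x).map fun z => z i) :=
      Measure.isProbabilityMeasure_map (hcoord i).aemeasurable
    have : IsProbabilityMeasure (μ'.map fun z => z i) :=
      Measure.isProbabilityMeasure_map (hcoord i).aemeasurable
    have hA : ∀ A, MeasurableSet A → ((empirical x).map fun z => z i).real A
        ≤ (μ'.map fun z => z i).real A + 1 / 3 := fun A hA => by
      rw [map_measureReal_apply (hcoord i) hA, map_measureReal_apply (hcoord i) hA]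
      linarith [measureReal_le_add_tvDist μ' (empirical x) (hcoord i hA)]
    have hmap := integral_map (μ := μ') (hcoord i).aemeasurable (f := fun y => |y - m i|)
      (by fun_prop)
    have key := abs_trimmedMean_third_sub_le hA (m i)
      ((integrable_map_measure (by fun_prop) (hcoord i).aemeasurable).2 (hi i))
    rw [hmap] at key
    rw [PiLp.smul_apply, hvI, smul_eq_mul]
    exact key.trans (le_abs_self _)
  calc ‖coordTrimmedMean (1 / 3) x - m‖ ≤ ‖(3 : ℝ) • ∫ z, v z ∂μ'‖ := by
        rw [EuclideanSpace.norm_eq, EuclideanSpace.norm_eq]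
        refine Real.sqrt_le_sqrt (Finset.sum_le_sum fun i _ => ?_)
        simpa only [Real.norm_eq_abs] using pow_le_pow_left₀ (abs_nonneg _) (hle i) 2
    _ ≤ 3 * ∫ z, ‖z - m‖ ∂μ' := by
        rw [norm_smul, Real.norm_of_nonneg (by norm_num : (0 : ℝ) ≤ 3)]
        gcongr
        simpa only [hvn] using norm_integral_le_integral_norm (μ := μ') v

/-- The strict inequality provides a coupling of cost below `r`. Its mean displacement is smaller
still by monotonicity of `L^p` norms, and the triangle inequality concludes. -/
lemma lintegral_enorm_sub_le_of_wasserstein_lt {d : ℕ} {p : ℝ} (hp : 1 ≤ p)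
    (μ ν : Measure (Space d)) [IsProbabilityMeasure μ] {r : ℝ≥0∞}
    (h : wasserstein p μ ν < r) (m : Space d) :
    ∫⁻ z, ‖z - m‖ₑ ∂μ ≤ r + ∫⁻ z, ‖z - m‖ₑ ∂ν := by
  simp only [wasserstein, iInf_lt_iff] at h
  obtain ⟨π, ⟨hfst, hsnd⟩, hπ⟩ := h
  have : IsProbabilityMeasure π := by
    constructor
    rw [← measure_univ (μ := μ), ← hfst, Measure.map_apply measurable_fst MeasurableSet.univ,
      Set.preimage_univ]
  have hp0 : 0 < p := by linarith
  have h1 : ∫⁻ z, ‖z.1 - z.2‖ₑ ∂π ≤ r := by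
    have := eLpNorm_le_eLpNorm_of_exponent_le (μ := π) (p := 1) (q := ENNReal.ofReal p)
      (by simpa using ENNReal.ofReal_le_ofReal hp) (f := fun z : Space d × Space d => z.1 - z.2)
      (by fun_prop)
    rw [eLpNorm_one_eq_lintegral_enorm, eLpNorm_eq_lintegral_rpow_enorm_toReal (by simpa)
      (by simp), ENNReal.toReal_ofReal hp0.le] at this
    exact this.trans hπ.le
  calc ∫⁻ z, ‖z - m‖ₑ ∂μ = ∫⁻ z, ‖z.1 - m‖ₑ ∂π := by
        rw [← hfst, lintegral_map (by fun_prop) measurable_fst]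
    _ ≤ ∫⁻ z, ‖z.1 - z.2‖ₑ + ‖z.2 - m‖ₑ ∂π := by
        refine lintegral_mono fun z => ?_
        rw [← sub_add_sub_cancel z.1 z.2 m]
        exact enorm_add_le _ _
    _ = (∫⁻ z, ‖z.1 - z.2‖ₑ ∂π) + ∫⁻ z, ‖z - m‖ₑ ∂ν := by
        rw [lintegral_add_left (by fun_prop), ← hsnd,
          lintegral_map (by fun_prop) measurable_snd]
    _ ≤ r + ∫⁻ z, ‖z - m‖ₑ ∂ν := by gcongr

/-- The deterministic estimate: the trimmed mean of the corrupted points is controlled by the mean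
deviation of the clean ones. -/
lemma norm_coordTrimmedMean_sub_le_of_robustWasserstein {n d : ℕ} [NeZero n] {p ε ρ₀ : ℝ}
    (hp : 1 ≤ p) (hε : ε ≤ 1 / 3) (hρ : 0 ≤ ρ₀) (x' x : Fin n → Space d)
    (h : robustWasserstein p ε (empirical x') (empirical x) ≤ ENNReal.ofReal ρ₀) (m : Space d) :
    ‖coordTrimmedMean (1 / 3) x' - m‖ ≤ 3 * (ρ₀ + 1 + (n : ℝ)⁻¹ * ∑ j, ‖x j - m‖) := by
  -- The infima need not be attained. The slack `1` gives a strict inequality, hence actual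
  -- competitors, and is later absorbed by `√d ≥ 1`.
  have hlt : robustWasserstein p ε (empirical x') (empirical x) < ENNReal.ofReal (ρ₀ + 1) :=
    h.trans_lt ((ENNReal.ofReal_lt_ofReal_iff (by linarith)).2 (by linarith))
  simp only [robustWasserstein, iInf_lt_iff] at hlt
  obtain ⟨μ', htv, hW⟩ := hlt
  have h1 := lintegral_enorm_sub_le_of_wasserstein_lt hp _ _ hW m
  have hS : 0 ≤ (n : ℝ)⁻¹ * ∑ j, ‖x j - m‖ := by positivity
  have h2 : ENNReal.ofReal (ρ₀ + 1) + ∫⁻ z, ‖z - m‖ₑ ∂(empirical x)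
      = ENNReal.ofReal (ρ₀ + 1 + (n : ℝ)⁻¹ * ∑ j, ‖x j - m‖) := by
    rw [lintegral_empirical x (by fun_prop), ENNReal.ofReal_add (by linarith) hS,
      ENNReal.ofReal_mul (by positivity), ENNReal.ofReal_sum_of_nonneg (fun _ _ => norm_nonneg _)]
    simp only [ofReal_norm]
    congr 2
    rw [ENNReal.ofReal, Real.toNNReal_inv, Real.toNNReal_natCast]
  rw [h2] at h1
  have hint : Integrable (fun z => ‖z - m‖) (μ' : Measure (Space d)) :=
    ⟨by fun_prop, by
      simp only [HasFiniteIntegral, enorm_norm]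
      exact h1.trans_lt ENNReal.ofReal_lt_top⟩
  refine (norm_coordTrimmedMean_sub_le x' _ (htv.trans hε) m hint).trans ?_
  gcongr
  rw [← ENNReal.ofReal_le_ofReal_iff (by linarith),
    ofReal_integral_eq_lintegral_ofReal hint (.of_forall fun _ => norm_nonneg _)]
  simpa only [ofReal_norm] using h1

/-! ### The mean deviation of the clean sample -/

/-- The squared mean deviation is at most the mean square, which is the trace of the covariance.
Each diagonal entry is at most `1` by positive semidefiniteness. -/
lemma integral_norm_sub_mean_le_sqrt {d : ℕ} {𝒵 : Set (Space d)} {μ : Measure (Space d)}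
    (hμ : μ ∈ boundedCov 𝒵) :
    Integrable (fun z => ‖z - ∫ w, w ∂μ‖) μ ∧ ∫ z, ‖z - ∫ w, w ∂μ‖ ∂μ ≤ Real.sqrt d := by
  obtain ⟨⟨hprob, -, hL⟩, hpsd⟩ := hμ
  have hL2 : MemLp (fun z : Space d => z) 2 μ := by simpa using hL
  set m := ∫ w, w ∂μ with hm
  have hsub : MemLp (fun z : Space d => z - m) 2 μ := hL2.sub (memLp_const m)
  have hint : Integrable (fun z => ‖z - m‖) μ := (hsub.integrable (by norm_num)).norm
  have hsq : Integrable (fun z => ‖z - m‖ ^ 2) μ := hsub.norm.integrable_sq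
  refine ⟨hint, Real.le_sqrt_of_sq_le ?_⟩
  have hcoord : ∀ i, MemLp (fun z : Space d => z i) 2 μ := fun i =>
    hL2.continuousLinearMap_comp (EuclideanSpace.proj (𝕜 := ℝ) i)
  have hmi : ∀ i, m i = ∫ z, z i ∂μ := fun i =>
    ((EuclideanSpace.proj (𝕜 := ℝ) i).integral_comp_comm (hL2.integrable (by norm_num))).symm
  have hvar : ∀ i, ∫ z, (z i - m i) ^ 2 ∂μ ≤ 1 := fun i => by
    have h1 := hpsd.diag_nonneg (i := i)
    simp only [Matrix.sub_apply, Matrix.one_apply_eq, covMat, Matrix.of_apply] at h1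
    rw [covariance_self (hcoord i).aemeasurable, variance_eq_integral (hcoord i).aemeasurable,
      ← hmi] at h1
    linarith
  have hci : ∀ i, Integrable (fun z : Space d => (z i - m i) ^ 2) μ := fun i =>
    ((hcoord i).sub (memLp_const (m i))).integrable_sq
  calc (∫ z, ‖z - m‖ ∂μ) ^ 2 ≤ ∫ z, ‖z - m‖ ^ 2 ∂μ := by
        have := variance_nonneg (fun z => ‖z - m‖) μ
        rw [variance_eq_sub hsub.norm] at this
        simpa using this
    _ = ∫ z, ∑ i, (z i - m i) ^ 2 ∂μ := by
        simp [EuclideanSpace.norm_sq_eq]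
    _ = ∑ i, ∫ z, (z i - m i) ^ 2 ∂μ := integral_finsetSum _ fun i _ => hci i
    _ ≤ ∑ _i : Fin d, (1 : ℝ) := Finset.sum_le_sum fun i _ => hvar i
    _ = d := by simp

/-- The coordinate-wise `1/3`-trimmed mean of a corrupted sample is a coarse estimate of the
mean. -/
theorem coordTrimmedMean_coarse {n d : ℕ} (hn : 1 ≤ n) (hd : 1 ≤ d) {Ω : Type*}
    [MeasurableSpace Ω] {P : Measure Ω} {𝒵 : Set (Space d)} {𝒢 : Set (Measure (Space d))}
    {p ε ρ₀ : ℝ} {μ : Measure (Space d)} {Z Z' : Fin n → Ω → Space d}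
    (hS : CorruptedSample P 𝒵 𝒢 p ε ρ₀ μ Z Z') (h𝒢 : 𝒢 ⊆ boundedCov 𝒵) (hε : ε ≤ 1 / 3) :
    0.99 ≤ P.real {ω | ‖coordTrimmedMean (1 / 3) (fun j => Z' j ω) - ∫ z, z ∂μ‖
      ≤ 303 * (Real.sqrt d + ρ₀)} := by
  have := hS.isProbabilityMeasure
  have : NeZero n := ⟨by omega⟩
  set m := ∫ z, z ∂μ with hm
  obtain ⟨hint, hdev⟩ := integral_norm_sub_mean_le_sqrt (h𝒢 hS.law_mem)
  rw [← hm] at hint hdev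
  have hmeas : ∀ j, Measurable fun ω => ‖Z j ω - m‖ := fun j =>
    ((hS.measurable_clean j).sub_const m).norm
  have hZint : ∀ j, Integrable (fun ω => ‖Z j ω - m‖) P := fun j => by
    rw [← hS.law j] at hint
    exact hint.comp_measurable (hS.measurable_clean j)
  have hZ : ∀ j, ∫ ω, ‖Z j ω - m‖ ∂P ≤ Real.sqrt d := fun j => by
    rw [← hS.law j, integral_map (hS.measurable_clean j).aemeasurable (by fun_prop)] at hdev
    exact hdev
  set S : Ω → ℝ := fun ω => (n : ℝ)⁻¹ * ∑ j, ‖Z j ω - m‖ with hSdef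
  have hSmeas : Measurable S := (Finset.measurable_sum _ fun j _ => hmeas j).const_mul _
  have hSint : Integrable S P := (integrable_finsetSum _ fun j _ => hZint j).const_mul _
  have hn0 : (0 : ℝ) < n := by exact_mod_cast hn
  have hd1 : 1 ≤ Real.sqrt d := Real.one_le_sqrt.2 (by exact_mod_cast hd)
  have hSmean : ∫ ω, S ω ∂P ≤ Real.sqrt d := by
    simp only [hSdef]
    rw [integral_const_mul, integral_finsetSum _ fun j _ => hZint j, inv_mul_le_iff₀ hn0]
    exact (Finset.sum_le_sum fun j _ => hZ j).trans (by simp)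
  have hmarkov := mul_meas_ge_le_integral_of_nonneg
    (.of_forall fun ω => by simp only [hSdef]; positivity) hSint (100 * Real.sqrt d)
  have hbad : P.real {ω | 100 * Real.sqrt d ≤ S ω} ≤ 1 / 100 := by
    have : 0 < 100 * Real.sqrt d := by linarith
    have h2 : 100 * Real.sqrt d * P.real {ω | 100 * Real.sqrt d ≤ S ω} ≤ Real.sqrt d :=
      hmarkov.trans hSmean
    nlinarith
  have hgood := probReal_compl_eq_one_sub (μ := P)
    (measurableSet_le (measurable_const (a := 100 * Real.sqrt d)) hSmeas)
  have hae : ({ω | 100 * Real.sqrt d ≤ S ω}ᶜ : Set Ω) ≤ᵐ[P]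
      {ω | ‖coordTrimmedMean (1 / 3) (fun j => Z' j ω) - m‖ ≤ 303 * (Real.sqrt d + ρ₀)} := by
    filter_upwards [hS.corruption] with ω hω hlt
    have hlt' : S ω < 100 * Real.sqrt d := not_le.1 hlt
    have := norm_coordTrimmedMean_sub_le_of_robustWasserstein hS.one_le_p hε hS.radius_nonneg
      _ _ hω m
    change _ ≤ 3 * (ρ₀ + 1 + S ω) at this
    change _ ≤ _
    -- `3 (ρ₀ + 1 + 100 √d) ≤ 303 (√d + ρ₀)`, as `√d ≥ 1`; the `100` is the Markov level for failure
    -- probability `1/100`.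
    linarith [hS.radius_nonneg]
  calc (0.99 : ℝ) ≤ P.real ({ω | 100 * Real.sqrt d ≤ S ω}ᶜ) := by
        rw [hgood]
        norm_num at hbad ⊢
        linarith
    _ ≤ _ := ENNReal.toReal_mono (measure_ne_top _ _) (measure_mono_ae hae)

end RobustMean

namespace RobustMean

/-! ### The trimmed mean of an empirical measure as a weighted sum of order statistics -/

/-- The length of `[3k, 3k + 3] ∩ [n, 2n]`. -/
def trimWeight (n k : ℕ) : ℕ := (3 * k + 3 - (3 * k + 3 - 2 * n)) - (3 * k + (n - 3 * k))

lemma cdf_empirical_coord {n d : ℕ} (hn : 0 < n) (x : Fin n → Space d) (i : Fin d) (v : ℝ) :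
    cdf ((empirical x).map fun z => z i) v
      = ((∑ j, if x j i ≤ v then 1 else 0 : ℕ) : ℝ) / n := by
  have : NeZero n := ⟨hn.ne'⟩
  have hm : Measurable fun z : Space d => z i := by fun_prop
  have : IsProbabilityMeasure ((empirical x).map fun z => z i) :=
    Measure.isProbabilityMeasure_map hm.aemeasurable
  have hs : MeasurableSet ((fun z : Space d => z i) ⁻¹' Set.Iic v) := hm measurableSet_Iic
  rw [cdf_eq_real, map_measureReal_apply hm measurableSet_Iic, measureReal_def,
    ← lintegral_indicator_one hs, lintegral_empirical x (measurable_one.indicator hs)]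
  have hsum : ∑ j, Set.indicator ((fun z : Space d => z i) ⁻¹' Set.Iic v) (1 : Space d → ℝ≥0∞) (x j)
      = ((∑ j, if x j i ≤ v then 1 else 0 : ℕ) : ℝ≥0∞) := by
    rw [Nat.cast_sum]
    refine Finset.sum_congr rfl fun j _ => ?_
    by_cases h : x j i ≤ v <;> simp [Set.indicator, h]
  rw [hsum, ENNReal.toReal_mul, ENNReal.toReal_natCast, ENNReal.coe_toReal, NNReal.coe_inv,
    NNReal.coe_natCast, inv_mul_eq_div]

variable {n : ℕ} {ν : Measure ℝ} {y : ℕ → ℝ}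

/-- For such `t`, at least `t * n` entries lie below `v` exactly when at least `k + 1` do, which by
sortedness means `y k ≤ v`. Indices start at `0`. -/
lemma quantile_eq_of_mem_Ioc (hn : 0 < n) (hmono : ∀ p q, p ≤ q → q < n → y p ≤ y q)
    (hcdf : ∀ v, cdf ν v = ((∑ p ∈ Finset.range n, if y p ≤ v then 1 else 0 : ℕ) : ℝ) / n)
    {t : ℝ} (h0 : 0 < t) (h1 : t < 1) {k : ℕ} (hk : k < n)
    (ht : t ∈ Set.Ioc ((k : ℝ) / n) (((k : ℝ) + 1) / n)) : quantile ν t = y k := by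
  have hn0 : (0 : ℝ) < n := by exact_mod_cast hn
  refine eq_of_forall_ge_iff fun v => ?_
  rw [quantile_le_iff ν h0 h1, hcdf, ← Finset.card_filter]
  constructor
  · intro h
    by_contra! hv
    have hsub : (Finset.range n).filter (fun p => y p ≤ v) ⊆ Finset.range k := fun p hp => by
      simp only [Finset.mem_filter, Finset.mem_range] at hp ⊢
      by_contra! hkp
      linarith [hmono k p hkp hp.1]
    have hcard : (((Finset.range n).filter fun p => y p ≤ v).card : ℝ) ≤ k := by
      exact_mod_cast (Finset.card_le_card hsub).trans (Finset.card_range k).le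
    exact absurd (ht.1.trans_le h) (not_lt.2 (by gcongr))
  · intro h
    have hsub : Finset.range (k + 1) ⊆ (Finset.range n).filter fun p => y p ≤ v := fun p hp => by
      simp only [Finset.mem_filter, Finset.mem_range] at hp ⊢
      exact ⟨by omega, (hmono p k (by omega) hk).trans h⟩
    have hcard : (k : ℝ) + 1 ≤ ((Finset.range n).filter fun p => y p ≤ v).card := by
      exact_mod_cast (Finset.card_range (k + 1)).ge.trans (Finset.card_le_card hsub)
    exact ht.2.trans (by gcongr)

lemma cast_sub_eq_max (a b : ℕ) : ((a - b : ℕ) : ℝ) = max ((a : ℝ) - b) 0 := by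
  rcases le_total a b with h | h
  · have h' : (a : ℝ) ≤ b := by exact_mod_cast h
    rw [Nat.sub_eq_zero_of_le h, max_eq_right (by linarith), Nat.cast_zero]
  · have h' : (b : ℝ) ≤ a := by exact_mod_cast h
    rw [Nat.cast_sub h, max_eq_left (by linarith)]

/-- Scaling by `3 * n` makes all endpoints integers. The nested truncated differences in
`trimWeight` are a minimum, a maximum and a positive part, the last giving `0` for an empty
intersection. -/
lemma volume_real_Ioc_inter_Ioc (hn : 0 < n) (k : ℕ) :
    volume.real (Set.Ioc ((k : ℝ) / n) (((k : ℝ) + 1) / n) ∩ Set.Ioc (1 / 3) (2 / 3))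
      = (trimWeight n k : ℝ) / (3 * n) := by
  have hn0 : (0 : ℝ) < n := by exact_mod_cast hn
  have hmin : ((3 * k + 3 - (3 * k + 3 - 2 * n) : ℕ) : ℝ)
      = 3 * n * min (((k : ℝ) + 1) / n) (2 / 3) := by
    rw [mul_min_of_nonneg _ _ (by positivity), show (3 * k + 3 - (3 * k + 3 - 2 * n) : ℕ)
      = min (3 * k + 3) (2 * n) by omega]
    push_cast
    congr 1 <;> field_simp
  have hmax : ((3 * k + (n - 3 * k) : ℕ) : ℝ) = 3 * n * max ((k : ℝ) / n) (1 / 3) := by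
    rw [mul_max_of_nonneg _ _ (by positivity), show (3 * k + (n - 3 * k) : ℕ)
      = max (3 * k) n by omega]
    push_cast
    congr 1 <;> field_simp
  rw [Set.Ioc_inter_Ioc, Real.volume_real_Ioc, eq_div_iff (by positivity), trimWeight,
    cast_sub_eq_max, hmin, hmax, max_mul_of_nonneg _ _ (by positivity)]
  congr 1 <;> ring

lemma trimmedMean_third_eq_sum (hn : 0 < n) (hmono : ∀ p q, p ≤ q → q < n → y p ≤ y q)
    (hcdf : ∀ v, cdf ν v = ((∑ p ∈ Finset.range n, if y p ≤ v then 1 else 0 : ℕ) : ℝ) / n) :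
    trimmedMean (1 / 3) ν = (∑ k ∈ Finset.range n, y k * trimWeight n k) / n := by
  have hn0 : (0 : ℝ) < n := by exact_mod_cast hn
  have hstep : ∀ t ∈ Set.Ioc (1 / 3 : ℝ) (2 / 3), quantile ν t
      = ∑ k ∈ Finset.range n,
        (Set.Ioc ((k : ℝ) / n) (((k : ℝ) + 1) / n)).indicator (fun _ => y k) t := by
    intro t ht
    have h0 : 0 < t := by linarith [ht.1]
    have h1 : t < 1 := by linarith [ht.2]
    have hc : 0 < ⌈t * n⌉₊ := Nat.ceil_pos.2 (by positivity)
    have hcn : ⌈t * n⌉₊ ≤ n := Nat.ceil_le.2 (by nlinarith)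
    -- The half-open cells are disjoint, and `t` lies in the one with index `⌈t * n⌉₊ - 1`.
    obtain ⟨k, hk⟩ : ∃ k, ⌈t * n⌉₊ = k + 1 := ⟨⌈t * n⌉₊ - 1, by omega⟩
    have hmem : ∀ l : ℕ, t ∈ Set.Ioc ((l : ℝ) / n) (((l : ℝ) + 1) / n) ↔ l = k := fun l => by
      rw [Set.mem_Ioc, div_lt_iff₀ hn0, le_div_iff₀ hn0, ← Nat.lt_ceil, hk,
        show (l : ℝ) + 1 = ((l + 1 : ℕ) : ℝ) by push_cast; ring, ← Nat.ceil_le, hk]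
      omega
    rw [Finset.sum_eq_single_of_mem k (Finset.mem_range.2 (by omega))
      fun l _ hl => Set.indicator_of_notMem (fun h => hl ((hmem l).1 h)) _,
      Set.indicator_of_mem ((hmem k).2 rfl)]
    exact quantile_eq_of_mem_Ioc hn hmono hcdf h0 h1 (by omega) ((hmem k).2 rfl)
  rw [trimmedMean, trimming, integral_map (aemeasurable_quantile ν (by norm_num)) (by fun_prop),
    ProbabilityTheory.cond, integral_smul_measure, Real.volume_Icc,
    show (1 - 1 / 3 : ℝ) = 2 / 3 by norm_num, show (2 / 3 - 1 / 3 : ℝ) = 3⁻¹ by norm_num,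
    integral_Icc_eq_integral_Ioc, setIntegral_congr_fun measurableSet_Ioc hstep,
    integral_finsetSum]
  · simp only [integral_indicator_const _ measurableSet_Ioc,
      measureReal_restrict_apply measurableSet_Ioc, volume_real_Ioc_inter_Ioc hn, smul_eq_mul]
    rw [ENNReal.toReal_inv, ENNReal.toReal_ofReal (by norm_num), inv_inv, Finset.mul_sum,
      Finset.sum_div]
    refine Finset.sum_congr rfl fun k _ => ?_
    field_simp
  · exact fun k _ => (integrable_const (y k)).indicator measurableSet_Ioc

/-- The trimmed mean of a coordinate, computed from a sorted rearrangement `y`. -/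
lemma coordTrimmedMean_third_eq_sum {d : ℕ} (hn : 0 < n) (x : Fin n → Space d) (i : Fin d)
    (hsorted : ∀ q, q + 1 < n → y q ≤ y (q + 1))
    (hperm : ∀ f : ℝ → ℕ, ∑ p ∈ Finset.range n, f (y p) = ∑ j, f (x j i)) :
    coordTrimmedMean (1 / 3) x i = (∑ k ∈ Finset.range n, y k * trimWeight n k) / n := by
  refine trimmedMean_third_eq_sum hn (fun p q hpq hq => ?_) fun v => ?_
  · induction q, hpq using Nat.le_induction with
    | base => exact le_rfl
    | succ q _ ih => exact (ih (by omega)).trans (hsorted q hq)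
  -- Indicators of half-lines as test functions turn the rearrangement hypothesis into equality of
  -- distribution functions.
  · rw [cdf_empirical_coord hn, hperm fun r => if r ≤ v then 1 else 0]

end RobustMean

namespace RealRAM

/-! ### Program logic -/

/-- Started in `s`, the program `c` halts within `T` steps in a state satisfying `Q`. -/
def RunsTo (c : Prog) (s : State) (T : ℕ) (Q : State → Prop) : Prop :=
  ∃ (t : ℕ) (s' : State), Run c s t s' ∧ t ≤ T ∧ Q s'

lemma RunsTo.mono {c : Prog} {s : State} {T T' : ℕ} {Q Q' : State → Prop} (h : RunsTo c s T Q)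
    (hT : T ≤ T') (hQ : ∀ s', Q s' → Q' s') : RunsTo c s T' Q' := by
  obtain ⟨t, s', hr, ht, hq⟩ := h
  exact ⟨t, s', hr, ht.trans hT, hQ _ hq⟩

lemma RunsTo.seq {c₁ c₂ : Prog} {s : State} {T₁ T₂ : ℕ} {Q R : State → Prop}
    (h₁ : RunsTo c₁ s T₁ Q) (h₂ : ∀ s', Q s' → RunsTo c₂ s' T₂ R) :
    RunsTo (.seq c₁ c₂) s (T₁ + T₂) R := by
  obtain ⟨t₁, s₁, hr₁, ht₁, hq₁⟩ := h₁
  obtain ⟨t₂, s₂, hr₂, ht₂, hq₂⟩ := h₂ s₁ hq₁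
  exact ⟨_, s₂, .seq hr₁ hr₂, add_le_add ht₁ ht₂, hq₂⟩

/-- Indexing the invariant by the iteration number yields termination, correctness and the time
bound at once. -/
lemma RunsTo.whileLoop {b : Test} {c : Prog} {N T : ℕ} {I : ℕ → State → Prop}
    (hstep : ∀ k < N, ∀ s, I k s → b.holds s ∧ RunsTo c s T (I (k + 1)))
    (hexit : ∀ s, I N s → ¬ b.holds s) {s : State} (h0 : I 0 s) :
    RunsTo (.while b c) s (N * (b.cost + T + 1) + (b.cost + 1)) (I N) := by
  suffices H : ∀ m k s, k + m = N → I k s →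
      RunsTo (.while b c) s (m * (b.cost + T + 1) + (b.cost + 1)) (I N) from
    H N 0 s (by omega) h0
  intro m
  induction m with
  | zero =>
    intro k s hk hI
    obtain rfl : k = N := by omega
    exact ⟨_, s, .whileFalse (hexit s hI), by omega, hI⟩
  | succ m ih =>
    intro k s hk hI
    obtain ⟨hb, t₁, s₁, hr₁, ht₁, hI₁⟩ := hstep k (by omega) s hI
    obtain ⟨t₂, s₂, hr₂, ht₂, hI₂⟩ := ih (k + 1) s₁ (by omega) hI₁
    refine ⟨_, s₂, .whileTrue hb hr₁ hr₂, ?_, hI₂⟩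
    rw [Nat.succ_mul]
    omega

open Classical in
/-- The effect of a loop-free program. -/
noncomputable def Prog.exec : Prog → State → State
  | .skip, s => s
  | .setReg r e, s => ⟨Function.update s.reg r (e.val s), s.mem⟩
  | .store k a e, s =>
    ⟨s.reg, Function.update s.mem k (Function.update (s.mem k) (a.val s) (e.val s))⟩
  | .seq c₁ c₂, s => c₂.exec (c₁.exec s)
  | .ite b c₁ c₂, s => if b.holds s then c₁.exec s else c₂.exec s
  | .while _ _, s => s

/-- No loops occur in the program. -/
def Prog.loopFree : Prog → Bool
  | .seq c₁ c₂ => c₁.loopFree && c₂.loopFree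
  | .ite _ c₁ c₂ => c₁.loopFree && c₂.loopFree
  | .while _ _ => false
  | _ => true

/-- The worst-case cost of a loop-free program. -/
def Prog.maxCost : Prog → ℕ
  | .skip => 1
  | .setReg _ e => e.cost + 1
  | .store _ a e => a.cost + e.cost + 1
  | .seq c₁ c₂ => c₁.maxCost + c₂.maxCost
  | .ite b c₁ c₂ => b.cost + (c₁.maxCost + c₂.maxCost) + 1
  | .while _ _ => 0

lemma Prog.exists_run_exec (c : Prog) (hc : c.loopFree = true) (s : State) :
    ∃ t, Run c s t (c.exec s) ∧ t ≤ c.maxCost := by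
  induction c generalizing s with
  | skip => exact ⟨_, .skip s, le_rfl⟩
  | setReg r e => exact ⟨_, .setReg s r e, le_rfl⟩
  | store k a e => exact ⟨_, .store s k a e, le_rfl⟩
  | seq c₁ c₂ ih₁ ih₂ =>
    simp only [loopFree, Bool.and_eq_true] at hc
    obtain ⟨t₁, h₁, l₁⟩ := ih₁ hc.1 s
    obtain ⟨t₂, h₂, l₂⟩ := ih₂ hc.2 (c₁.exec s)
    exact ⟨_, .seq h₁ h₂, add_le_add l₁ l₂⟩
  | ite b c₁ c₂ ih₁ ih₂ =>
    simp only [loopFree, Bool.and_eq_true] at hc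
    obtain ⟨t₁, h₁, l₁⟩ := ih₁ hc.1 s
    obtain ⟨t₂, h₂, l₂⟩ := ih₂ hc.2 s
    by_cases hb : b.holds s
    · refine ⟨_, by simpa only [exec, if_pos hb] using Run.iteTrue (c₂ := c₂) hb h₁, ?_⟩
      simp only [maxCost]
      omega
    · refine ⟨_, by simpa only [exec, if_neg hb] using Run.iteFalse (c₁ := c₁) hb h₂, ?_⟩
      simp only [maxCost]
      omega
  | _ => simp [loopFree] at hc

/-- Straight-line code is verified by evaluation: `decide` checks its cost against a generous
numeral, and simplification computes the final state. -/
lemma RunsTo.of_exec {c : Prog} {s : State} {T : ℕ} {Q : State → Prop}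
    (hc : c.loopFree = true) (hT : c.maxCost ≤ T) (hQ : Q (c.exec s)) : RunsTo c s T Q := by
  obtain ⟨t, hr, ht⟩ := c.exists_run_exec hc s
  exact ⟨t, _, hr, ht.trans hT, hQ⟩

/-! ### Merging sorted blocks -/

/-- The array `a` is nondecreasing on `[0, n)` except possibly at multiples of `w`. -/
def BlockSorted (n w : ℕ) (a : ℕ → ℝ) : Prop :=
  ∀ q, q + 1 < n → ¬ w ∣ q + 1 → a q ≤ a (q + 1)

/-- The invariant of the merge loop: `k` cells of `b` have been written, and the current block of
`a` has the unread parts `[i, mid)` and `[j, hi)`. -/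
structure MergeInv (n w k i mid j hi : ℕ) (a b : ℕ → ℝ) : Prop where
  i_le : i ≤ mid
  mid_le : mid ≤ j
  j_le : j ≤ hi
  hi_le : hi ≤ n
  count : k + mid = i + j
  perm : ∀ f : ℝ → ℕ, ∑ p ∈ Finset.range k, f (b p)
    = ∑ p ∈ Finset.range i, f (a p) + ∑ p ∈ Finset.Ico mid j, f (a p)
  sorted : BlockSorted k (2 * w) b
  block : k < hi → ∃ B, 2 * w ∣ B ∧ B ≤ i ∧ mid = min (B + w) n ∧ hi = min (B + 2 * w) n ∧
    (B < k → (i < mid → b (k - 1) ≤ a i) ∧ (j < hi → b (k - 1) ≤ a j))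
  boundary : k = hi → 2 * w ∣ k ∨ k = n

namespace MergeInv

variable {n w k i mid j hi : ℕ} {a b : ℕ → ℝ}

/-- Zero pointers describe an exhausted empty block, so the first block needs no special case. -/
lemma init (n w : ℕ) (a b : ℕ → ℝ) : MergeInv n w 0 0 0 0 0 a b where
  i_le := le_rfl
  mid_le := le_rfl
  j_le := le_rfl
  hi_le := Nat.zero_le _
  count := rfl
  perm := by simp
  sorted := fun q hq => by omega
  block := fun h => by omega
  boundary := fun _ => .inl (dvd_zero _)

/-- The count forces `i = mid` and `j = k`, so exactly the prefix `[0, k)` of `a` has been consumed.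
As `k < n`, `boundary` makes `k` a multiple of `2 * w`. -/
lemma nextBlock (h : MergeInv n w k i mid j hi a b) (hw : 0 < w) (hk : k < n) (hhi : hi ≤ k) :
    MergeInv n w k k (min (k + w) n) (min (k + w) n) (min (k + 2 * w) n) a b where
  i_le := by omega
  mid_le := le_rfl
  j_le := by omega
  hi_le := by omega
  count := rfl
  perm := fun f => by
    have := h.i_le; have := h.mid_le; have := h.j_le; have := h.count
    obtain rfl : i = mid := by omega
    obtain rfl : k = j := by omega
    rw [h.perm f, Finset.Ico_self, Finset.sum_empty, add_zero,
      Finset.sum_range_add_sum_Ico _ h.mid_le]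
  sorted := h.sorted
  block := fun _ => by
    have := h.i_le; have := h.j_le; have := h.count
    refine ⟨k, ?_, le_rfl, rfl, rfl, fun hlt => absurd hlt (lt_irrefl _)⟩
    exact (h.boundary (by omega)).resolve_right (by omega)
  boundary := fun hk' => by omega

lemma perm_update (b : ℕ → ℝ) (k : ℕ) (v : ℝ) (f : ℝ → ℕ) :
    ∑ p ∈ Finset.range (k + 1), f (Function.update b k v p)
      = ∑ p ∈ Finset.range k, f (b p) + f v := by
  rw [Finset.sum_range_succ, Function.update_self]
  congr 1
  refine Finset.sum_congr rfl fun p hp => ?_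
  rw [Function.update_of_ne (Finset.mem_range.1 hp).ne]

lemma sorted_update (hs : BlockSorted k (2 * w) b) {v : ℝ}
    (hv : 0 < k → ¬ 2 * w ∣ k → b (k - 1) ≤ v) :
    BlockSorted (k + 1) (2 * w) (Function.update b k v) := by
  intro q hq hdvd
  rw [Function.update_of_ne (by omega : q ≠ k)]
  by_cases hqk : q + 1 = k
  · subst hqk
    simpa using hv (by omega) hdvd
  · rw [Function.update_of_ne hqk]
    exact hs q (by omega) hdvd

lemma not_dvd_of_between {B q : ℕ} (hB : w ∣ B) (h1 : B < q) (h2 : q < B + w) : ¬ w ∣ q := by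
  intro hq
  have := Nat.le_of_dvd (by omega) (Nat.dvd_sub hq hB)
  omega

/-- The last entry written stays below both heads: below the next left entry because position `i +
1` is interior to a sorted block, below the right head by `hle`. -/
lemma takeLeft (h : MergeInv n w k i mid j hi a b) (ha : BlockSorted n w a) (hk : k < hi)
    (hi' : i < mid) (hle : j < hi → a i ≤ a j) :
    MergeInv n w (k + 1) (i + 1) mid j hi a (Function.update b k (a i)) := by
  have h1 := h.mid_le; have h2 := h.j_le; have h3 := h.hi_le; have h4 := h.count
  obtain ⟨B, hB, hBi, hmid, hhi, hlast⟩ := h.block hk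
  have hwB : w ∣ B := (Dvd.intro_left 2 rfl).trans hB
  refine ⟨hi', h1, h2, h3, by omega, fun f => ?_, sorted_update h.sorted fun _ hnd => ?_,
    fun hk1 => ⟨B, hB, by omega, hmid, hhi, fun _ => ⟨fun hlt => ?_, fun hj => ?_⟩⟩, fun hk1 => ?_⟩
  · rw [perm_update, h.perm, Finset.sum_range_succ]
    ring
  -- If `k = B`, a new output block starts and no comparison is required.
  · refine (hlast (lt_of_le_of_ne (by omega) ?_)).1 hi'
    rintro rfl
    exact hnd hB
  · simpa using ha i (by omega) (not_dvd_of_between hwB (by omega) (by omega))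
  · simpa using hle hj
  · by_cases hn : n ≤ B + 2 * w
    · right; omega
    · left
      rw [show k + 1 = B + 2 * w by omega]
      exact Nat.dvd_add_self_right.2 hB

lemma takeRight (h : MergeInv n w k i mid j hi a b) (ha : BlockSorted n w a) (hk : k < hi)
    (hj : j < hi) (hle : i < mid → a j ≤ a i) :
    MergeInv n w (k + 1) i mid (j + 1) hi a (Function.update b k (a j)) := by
  have h0 := h.i_le; have h1 := h.mid_le; have h3 := h.hi_le; have h4 := h.count
  obtain ⟨B, hB, hBi, hmid, hhi, hlast⟩ := h.block hk
  have hwB : w ∣ B := (Dvd.intro_left 2 rfl).trans hB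
  refine ⟨h0, by omega, hj, h3, by omega, fun f => ?_, sorted_update h.sorted fun _ hnd => ?_,
    fun hk1 => ⟨B, hB, by omega, hmid, hhi, fun _ => ⟨fun hlt => ?_, fun hlt => ?_⟩⟩,
    fun hk1 => ?_⟩
  · rw [perm_update, h.perm, Finset.sum_Ico_succ_top h1]
    ring
  · refine (hlast (lt_of_le_of_ne (by omega) ?_)).2 hj
    rintro rfl
    exact hnd hB
  · simpa using hle hlt
  -- The right block starts at `B + w`, so `j + 1` lies strictly between consecutive multiples of
  -- `w`.
  · simpa using ha j (by omega)
      (not_dvd_of_between ((Nat.dvd_add_self_right).2 hwB) (B := B + w) (by omega) (by omega))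
  · by_cases hn : n ≤ B + 2 * w
    · right; omega
    · left
      rw [show k + 1 = B + 2 * w by omega]
      exact Nat.dvd_add_self_right.2 hB

lemma perm_of_eq (h : MergeInv n w n i mid j hi a b) (f : ℝ → ℕ) :
    ∑ p ∈ Finset.range n, f (b p) = ∑ p ∈ Finset.range n, f (a p) := by
  have h0 := h.i_le; have h1 := h.mid_le; have h2 := h.j_le; have h3 := h.hi_le
  have h4 := h.count
  obtain rfl : i = mid := by omega
  obtain rfl : n = j := by omega
  rw [h.perm f, Finset.sum_range_add_sum_Ico _ h1]

end MergeInv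

/-! ### The program

Register `0` holds `n`, register `1` holds `d`, register `2` the current coordinate. Array `2` holds
the current column and array `3` the output of a merging pass. -/

/-- Test `e < f`. -/
abbrev idxLt (e f : IdxExpr) : Test := .idxLe (e.add (.const 1)) f

/-- Increment a register. -/
abbrev inc (r : ℕ) : Prog := .setReg r ((IdxExpr.reg r).add (.const 1))

/-- The index expression `min e f`. -/
abbrev idxMin (e f : IdxExpr) : IdxExpr := e.sub (e.sub f)

/-- Copy entry `j` of the current column. -/
def loadBody : Prog :=
  .seq (.store 2 (.reg 3) (.load 0 (.reg 4)))
    (.seq (.setReg 4 ((IdxExpr.reg 4).add (.reg 1))) (inc 3))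

/-- Copy the current column into array `2`. -/
def loadColumn : Prog :=
  .seq (.seq (.setReg 3 (.const 0)) (.setReg 4 (.reg 2)))
    (.while (idxLt (.reg 3) (.reg 0)) loadBody)

/-- Move on to the next pair of blocks if the current one is exhausted. -/
def advanceBlock : Prog :=
  .ite (.idxLe (.reg 9) (.reg 3))
    (.seq (.setReg 6 (.reg 3))
      (.seq (.setReg 7 (idxMin ((IdxExpr.reg 3).add (.reg 5)) (.reg 0)))
        (.seq (.setReg 8 (.reg 7))
          (.setReg 9 (idxMin (((IdxExpr.reg 3).add (.reg 5)).add (.reg 5)) (.reg 0))))))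
    .skip

/-- Test whether the next output entry comes from the left block. -/
def fromLeft : Test :=
  .and (idxLt (.reg 6) (.reg 7))
    (.not (.and (idxLt (.reg 8) (.reg 9))
      (.not (.realLe (.load 2 (.reg 6)) (.load 2 (.reg 8))))))

/-- Write one output entry. -/
def mergeStep : Prog :=
  .seq (.ite fromLeft
      (.seq (.store 3 (.reg 3) (.load 2 (.reg 6))) (inc 6))
      (.seq (.store 3 (.reg 3) (.load 2 (.reg 8))) (inc 8)))
    (inc 3)

/-- Merge all pairs of adjacent blocks of array `2` into array `3`. -/
def mergePass : Prog :=
  .seq (.seq (.setReg 3 (.const 0)) (.seq (.setReg 6 (.const 0)) (.seq (.setReg 7 (.const 0))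
      (.seq (.setReg 8 (.const 0)) (.setReg 9 (.const 0))))))
    (.while (idxLt (.reg 3) (.reg 0)) (.seq advanceBlock mergeStep))

/-- Copy one entry back. -/
def copyBody : Prog := .seq (.store 2 (.reg 3) (.load 3 (.reg 3))) (inc 3)

/-- Copy array `3` into array `2`. -/
def copyBack : Prog :=
  .seq (.setReg 3 (.const 0)) (.while (idxLt (.reg 3) (.reg 0)) copyBody)

/-- Bottom-up merge sort of the first `n` cells of array `2`. -/
def mergeSort : Prog :=
  .seq (.setReg 5 (.const 1))
    (.while (idxLt (.reg 5) (.reg 0))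
      (.seq mergePass (.seq copyBack (.setReg 5 ((IdxExpr.reg 5).add (.reg 5))))))

/-- The index expression `3 * k`. -/
abbrev thrice : IdxExpr := ((IdxExpr.reg 3).add (.reg 3)).add (.reg 3)

/-- The weight of the `k`-th order statistic. -/
def weightExpr : IdxExpr :=
  .sub (idxMin (thrice.add (.const 3)) ((IdxExpr.reg 0).add (.reg 0)))
    (thrice.add ((IdxExpr.reg 0).sub thrice))

/-- Add one weighted order statistic. -/
def sumBody : Prog :=
  .seq (.store 1 (.reg 2) ((RealExpr.load 1 (.reg 2)).add
      ((RealExpr.load 2 (.reg 3)).mul (.ofIdx weightExpr))))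
    (inc 3)

/-- Compute the weighted mean of the order statistics into the current output cell. -/
def weightedMean : Prog :=
  .seq (.seq (.store 1 (.reg 2) (.ofIdx (.const 0))) (.setReg 3 (.const 0)))
    (.seq (.while (idxLt (.reg 3) (.reg 0)) sumBody)
      (.store 1 (.reg 2) ((RealExpr.load 1 (.reg 2)).div (.ofIdx (.reg 0)))))

/-- The coordinate-wise `1/3`-trimmed mean. -/
def trimmedMeanProg : Prog :=
  .while (idxLt (.reg 2) (.reg 1))
    (.seq loadColumn (.seq mergeSort (.seq weightedMean (inc 2))))

/-! ### Correctness and running time -/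

/-- The part of the state that sorting a column leaves alone. -/
structure Ctx (n d i : ℕ) (M₀ M₁ : ℕ → ℝ) (s : State) : Prop where
  reg0 : s.reg 0 = n
  reg1 : s.reg 1 = d
  reg2 : s.reg 2 = i
  mem0 : s.mem 0 = M₀
  mem1 : s.mem 1 = M₁

variable {n d i : ℕ} {M₀ M₁ : ℕ → ℝ} {s : State}

/-- Index expressions have no product; register `4` reaches the address `p * d + i` by repeated
addition of `d`. -/
lemma loadColumn_spec (h : Ctx n d i M₀ M₁ s) :
    RunsTo loadColumn s (100 * n + 100)
      fun s' => Ctx n d i M₀ M₁ s' ∧ ∀ p < n, s'.mem 2 p = M₀ (p * d + i) := by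
  refine (RunsTo.seq (T₁ := 20) (Q := fun s' => Ctx n d i M₀ M₁ s' ∧ s'.reg 3 = 0 ∧
    s'.reg 4 = i) (.of_exec (by decide) (by decide) ?_) fun s' hs' => RunsTo.whileLoop (N := n) (T := 40)
      (I := fun k s => Ctx n d i M₀ M₁ s ∧ s.reg 3 = k ∧ s.reg 4 = k * d + i ∧
        ∀ p < k, s.mem 2 p = M₀ (p * d + i)) ?_ ?_ ?_).mono ?_ ?_
  · obtain ⟨h0, h1, h2, h3, h4⟩ := h
    refine ⟨⟨?_, ?_, ?_, ?_, ?_⟩, ?_, ?_⟩ <;> simp [Prog.exec, IdxExpr.val, *]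
  · rintro k hk s ⟨⟨h0, h1, h2, h3, h4⟩, hr3, hr4, hm⟩
    refine ⟨by simp only [Test.holds, IdxExpr.val]; omega, .of_exec (by decide) (by decide) ?_⟩
    refine ⟨⟨?_, ?_, ?_, ?_, ?_⟩, ?_, ?_, fun p hp => ?_⟩
    case refine_8 =>
      by_cases hpk : p = k
      · simp [loadBody, Prog.exec, IdxExpr.val, RealExpr.val, *]
      · simp [loadBody, Prog.exec, IdxExpr.val, RealExpr.val, hr3, hpk,
          hm p (by omega)]
    case refine_7 =>
      simp [loadBody, Prog.exec, IdxExpr.val, RealExpr.val, *]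
      ring
    all_goals simp [loadBody, Prog.exec, IdxExpr.val, RealExpr.val, *]
  · rintro s ⟨hc, hr3, -⟩
    simp only [Test.holds, IdxExpr.val, hr3, hc.reg0]
    omega
  · exact ⟨hs'.1, hs'.2.1, by simp [hs'.2.2], fun p hp => by omega⟩
  · simp only [Test.cost, IdxExpr.cost]
    omega
  · exact fun s hs => ⟨hs.1, hs.2.2.2⟩

/-- The state during a merging pass over `a`. -/
structure PassState (n d i : ℕ) (M₀ M₁ : ℕ → ℝ) (w : ℕ) (a : ℕ → ℝ) (k : ℕ) (s : State) :
    Prop extends Ctx n d i M₀ M₁ s where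
  reg5 : s.reg 5 = w
  mem2 : s.mem 2 = a
  reg3 : s.reg 3 = k
  inv : MergeInv n w k (s.reg 6) (s.reg 7) (s.reg 8) (s.reg 9) a (s.mem 3)

variable {w k : ℕ} {a : ℕ → ℝ}

lemma advanceBlock_spec (hw : 0 < w) (hk : k < n) (h : PassState n d i M₀ M₁ w a k s) :
    RunsTo advanceBlock s 60 fun s' => PassState n d i M₀ M₁ w a k s' ∧ k < s'.reg 9 := by
  refine .of_exec (by decide) (by decide) ?_
  obtain ⟨⟨h0, h1, h2, h3, h4⟩, h5, h6, h7, hinv⟩ := h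
  by_cases hhi : s.reg 9 ≤ k
  · have hnext := hinv.nextBlock hw hk hhi
    have e1 : k + w - (k + w - n) = min (k + w) n := by omega
    have e2 : k + w + w - (k + w + w - n) = min (k + 2 * w) n := by omega
    refine ⟨⟨⟨?_, ?_, ?_, ?_, ?_⟩, ?_, ?_, ?_, ?_⟩, ?_⟩ <;>
      simp only [advanceBlock, Prog.exec, Test.holds, IdxExpr.val, h7, hhi, if_true] <;>
      simp [h0, h1, h2, h3, h4, h5, h6, h7, e1, e2, hnext]
    omega
  · simp only [advanceBlock, Prog.exec, Test.holds, IdxExpr.val, h7, hhi, if_false]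
    exact ⟨⟨⟨h0, h1, h2, h3, h4⟩, h5, h6, h7, hinv⟩, by omega⟩

lemma mergeStep_spec (ha : BlockSorted n w a) (h : PassState n d i M₀ M₁ w a k s)
    (hk : k < s.reg 9) : RunsTo mergeStep s 60 (PassState n d i M₀ M₁ w a (k + 1)) := by
  refine .of_exec (by decide) (by decide) ?_
  obtain ⟨⟨h0, h1, h2, h3, h4⟩, h5, h6, h7, hinv⟩ := h
  have hcount := hinv.count
  have hile := hinv.i_le
  by_cases hl : fromLeft.holds s
  · have hl' := hl
    simp only [fromLeft, Test.holds, IdxExpr.val, RealExpr.val, h6] at hl'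
    have hnext := hinv.takeLeft ha hk (by omega) fun hj => by
      by_contra hle
      exact hl'.2 ⟨by omega, hle⟩
    refine ⟨⟨?_, ?_, ?_, ?_, ?_⟩, ?_, ?_, ?_, ?_⟩ <;>
      simp only [mergeStep, Prog.exec, hl, if_true] <;>
      simp [IdxExpr.val, RealExpr.val, h0, h1, h2, h3, h4, h5, h6, h7, hnext]
  · have hl' := hl
    simp only [fromLeft, Test.holds, IdxExpr.val, RealExpr.val, h6] at hl'
    -- Were the right block exhausted, the count and `k < hi` would leave the left one nonempty, and
    -- the test would succeed.
    have hnext := hinv.takeRight ha hk (by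
        by_contra hj
        exact hl' ⟨by omega, fun hj' => by omega⟩) fun hi' => by
      by_contra hle
      exact hl' ⟨by omega, fun hj => hj.2 (not_le.1 hle).le⟩
    refine ⟨⟨?_, ?_, ?_, ?_, ?_⟩, ?_, ?_, ?_, ?_⟩ <;>
      simp only [mergeStep, Prog.exec, hl, if_false] <;>
      simp [IdxExpr.val, RealExpr.val, h0, h1, h2, h3, h4, h5, h6, h7, hnext]

lemma mergePass_spec (hw : 0 < w) (h : Ctx n d i M₀ M₁ s) (h5 : s.reg 5 = w)
    (ha : BlockSorted n w (s.mem 2)) :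
    RunsTo mergePass s (150 * n + 100) (PassState n d i M₀ M₁ w (s.mem 2) n) := by
  refine (RunsTo.seq (T₁ := 30) (Q := PassState n d i M₀ M₁ w (s.mem 2) 0)
    (.of_exec (by decide) (by decide) ?_) fun s' hs' => RunsTo.whileLoop (N := n) (T := 120)
      (I := PassState n d i M₀ M₁ w (s.mem 2)) ?_ ?_ hs').mono ?_ fun _ h => h
  · obtain ⟨h0, h1, h2, h3, h4⟩ := h
    have := MergeInv.init n w (s.mem 2) (s.mem 3)
    refine ⟨⟨?_, ?_, ?_, ?_, ?_⟩, ?_, ?_, ?_, ?_⟩ <;>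
      simp [Prog.exec, IdxExpr.val, *]
  · refine fun k hk s hs => ⟨?_, (advanceBlock_spec hw hk hs).seq fun s' hs' =>
      mergeStep_spec ha hs'.1 hs'.2⟩
    simp only [Test.holds, IdxExpr.val, hs.reg3, hs.reg0]
    omega
  · intro s hs
    simp only [Test.holds, IdxExpr.val, hs.reg3, hs.reg0]
    omega
  · simp only [Test.cost, IdxExpr.cost]
    omega

lemma copyBack_spec (h : Ctx n d i M₀ M₁ s) (h5 : s.reg 5 = w) :
    RunsTo copyBack s (100 * n + 100)
      fun s' => Ctx n d i M₀ M₁ s' ∧ s'.reg 5 = w ∧ ∀ p < n, s'.mem 2 p = s.mem 3 p := by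
  refine (RunsTo.seq (T₁ := 20) (Q := fun s' => Ctx n d i M₀ M₁ s' ∧ s'.reg 5 = w ∧
    s'.mem 3 = s.mem 3 ∧ s'.reg 3 = 0) (.of_exec (by decide) (by decide) ?_)
    fun s' hs' => RunsTo.whileLoop (N := n) (T := 40)
      (I := fun k s' => Ctx n d i M₀ M₁ s' ∧ s'.reg 5 = w ∧ s'.mem 3 = s.mem 3 ∧ s'.reg 3 = k ∧
        ∀ p < k, s'.mem 2 p = s.mem 3 p) ?_ ?_ ?_).mono ?_ ?_
  · obtain ⟨h0, h1, h2, h3, h4⟩ := h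
    refine ⟨⟨?_, ?_, ?_, ?_, ?_⟩, ?_, ?_, ?_⟩ <;>
      simp [Prog.exec, IdxExpr.val, *]
  · rintro k hk s ⟨⟨h0, h1, h2, h3, h4⟩, hr5, hm3, hr3, hm⟩
    refine ⟨by simp only [Test.holds, IdxExpr.val]; omega, .of_exec (by decide) (by decide) ?_⟩
    refine ⟨⟨?_, ?_, ?_, ?_, ?_⟩, ?_, ?_, ?_, fun p hp => ?_⟩
    case refine_9 =>
      by_cases hpk : p = k
      · simp [copyBody, Prog.exec, IdxExpr.val, RealExpr.val, *]
      · simp [copyBody, Prog.exec, IdxExpr.val, RealExpr.val, hr3, hpk,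
          hm p (by omega)]
    all_goals simp [copyBody, Prog.exec, IdxExpr.val, RealExpr.val, *]
  · rintro s ⟨hc, -, -, hr3, -⟩
    simp only [Test.holds, IdxExpr.val, hr3, hc.reg0]
    omega
  · exact ⟨hs'.1, hs'.2.1, hs'.2.2.1, hs'.2.2.2, fun p hp => by omega⟩
  · simp only [Test.cost, IdxExpr.cost]
    omega
  · exact fun s hs => ⟨hs.1, hs.2.1, hs.2.2.2.2⟩

/-- `a` is a rearrangement of `b` on `[0, n)`. -/
def Rearranges (n : ℕ) (a b : ℕ → ℝ) : Prop :=
  ∀ f : ℝ → ℕ, ∑ p ∈ Finset.range n, f (a p) = ∑ p ∈ Finset.range n, f (b p)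

/-- After `m` passes the block width is `2 ^ m`. At `m = Nat.clog 2 n` it is at least `n`, so no
exceptional position remains inside `[0, n)`. -/
lemma mergeSort_spec (h : Ctx n d i M₀ M₁ s) :
    RunsTo mergeSort s (Nat.clog 2 n * (250 * n + 250) + 100) fun s' => Ctx n d i M₀ M₁ s' ∧
      (∀ q, q + 1 < n → s'.mem 2 q ≤ s'.mem 2 (q + 1)) ∧ Rearranges n (s'.mem 2) (s.mem 2) := by
  have hclog : ∀ m, m < Nat.clog 2 n ↔ 2 ^ m < n := fun m => Nat.lt_clog_iff_pow_lt (by norm_num)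
  refine (RunsTo.seq (T₁ := 20) (Q := fun s' => Ctx n d i M₀ M₁ s' ∧ s'.mem 2 = s.mem 2 ∧
    s'.reg 5 = 1) (.of_exec (by decide) (by decide) ?_)
    fun s' hs' => RunsTo.whileLoop (N := Nat.clog 2 n) (T := (150 * n + 100) + ((100 * n + 100) + 20))
      (I := fun m s' => Ctx n d i M₀ M₁ s' ∧ s'.reg 5 = 2 ^ m ∧ BlockSorted n (2 ^ m) (s'.mem 2) ∧
        Rearranges n (s'.mem 2) (s.mem 2)) ?_ ?_ ?_).mono ?_ ?_
  · obtain ⟨h0, h1, h2, h3, h4⟩ := h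
    refine ⟨⟨?_, ?_, ?_, ?_, ?_⟩, ?_, ?_⟩ <;>
      simp [Prog.exec, IdxExpr.val, *]
  · rintro m hm s₁ ⟨hc, hr5, hsorted, hperm⟩
    have hlt := (hclog m).1 hm
    refine ⟨?_, (mergePass_spec (by positivity) hc hr5 hsorted).seq fun s₂ hs₂ =>
      (copyBack_spec hs₂.toCtx hs₂.reg5).seq fun s₃ ⟨⟨h0, h1, h2, h3, h4⟩, hr5', hcopy⟩ =>
        .of_exec (by decide) (by decide) ?_⟩
    · simp only [Test.holds, IdxExpr.val, hr5, hc.reg0]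
      omega
    · refine ⟨⟨?_, ?_, ?_, ?_, ?_⟩, ?_, fun q hq hdvd => ?_, fun f => ?_⟩
      case refine_6 =>
        simp [Prog.exec, IdxExpr.val, hr5', pow_succ]
        ring
      case refine_7 =>
        simp only [Prog.exec]
        rw [hcopy _ hq, hcopy _ (by omega)]
        exact hs₂.inv.sorted q hq (by rwa [← pow_succ'])
      case refine_8 =>
        simp only [Prog.exec]
        rw [← hperm f, ← hs₂.inv.perm_of_eq f]
        exact Finset.sum_congr rfl fun p hp => by rw [hcopy p (Finset.mem_range.1 hp)]
      all_goals simp [Prog.exec, *]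
  · rintro s₁ ⟨hc, hr5, -⟩
    have := (hclog (Nat.clog 2 n)).not.1 (lt_irrefl _)
    simp only [Test.holds, IdxExpr.val, hr5, hc.reg0]
    omega
  -- At width `1` every position is exceptional, so block sortedness is vacuous.
  · exact ⟨hs'.1, by simp [hs'.2.2], fun q _ hq => absurd (one_dvd (q + 1)) hq,
      fun f => by rw [hs'.2.1]⟩
  · have : Nat.clog 2 n * (1 + 1 + 1 + 1 + 1 + (150 * n + 100 + (100 * n + 100 + 20)) + 1)
        ≤ Nat.clog 2 n * (250 * n + 250) := Nat.mul_le_mul_left _ (by omega)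
    simp only [Test.cost, IdxExpr.cost]
    omega
  · rintro s₁ ⟨hc, -, hsorted, hperm⟩
    have := (hclog (Nat.clog 2 n)).not.1 (lt_irrefl _)
    exact ⟨hc, fun q hq => hsorted q hq fun hdvd =>
      absurd (Nat.le_of_dvd (by omega) hdvd) (by omega), hperm⟩

lemma weightExpr_val (s : State) :
    weightExpr.val s = RobustMean.trimWeight (s.reg 0) (s.reg 3) := by
  simp only [weightExpr, IdxExpr.val, RobustMean.trimWeight]
  omega

lemma weightedMean_spec (h : Ctx n d i M₀ M₁ s) :
    RunsTo weightedMean s (100 * n + 100) (Ctx n d i M₀ (Function.update M₁ i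
      ((∑ k ∈ Finset.range n, s.mem 2 k * RobustMean.trimWeight n k) / n))) := by
  refine (RunsTo.seq (T₁ := 20) (Q := fun s' => Ctx n d i M₀ (Function.update M₁ i 0) s' ∧
    s'.mem 2 = s.mem 2 ∧ s'.reg 3 = 0) (.of_exec (by decide) (by decide) ?_)
    fun s' hs' => (RunsTo.whileLoop (N := n) (T := 60)
      (I := fun k s' => Ctx n d i M₀ (Function.update M₁ i
        (∑ k ∈ Finset.range k, s.mem 2 k * RobustMean.trimWeight n k)) s' ∧ s'.mem 2 = s.mem 2 ∧
        s'.reg 3 = k) ?_ ?_ ?_).seq (T₂ := 20) fun s' ⟨⟨h0, h1, h2, h3, h4⟩, _, _⟩ =>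
          .of_exec (by decide) (by decide) ?_).mono ?_ fun _ h => h
  · obtain ⟨h0, h1, h2, h3, h4⟩ := h
    refine ⟨⟨?_, ?_, ?_, ?_, ?_⟩, ?_, ?_⟩ <;>
      simp [Prog.exec, IdxExpr.val, RealExpr.val, *]
  · rintro k hk s' ⟨⟨h0, h1, h2, h3, h4⟩, hm2, hr3⟩
    refine ⟨by simp only [Test.holds, IdxExpr.val]; omega, .of_exec (by decide) (by decide) ?_⟩
    refine ⟨⟨?_, ?_, ?_, ?_, ?_⟩, ?_, ?_⟩ <;>
      simp [sumBody, Prog.exec, IdxExpr.val, RealExpr.val, weightExpr_val, Finset.sum_range_succ,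
        h0, h1, h2, h3, h4, hm2, hr3]
  · rintro s' ⟨hc, -, hr3⟩
    simp only [Test.holds, IdxExpr.val, hr3, hc.reg0]
    omega
  · exact ⟨by simpa using hs'.1, hs'.2⟩
  · refine ⟨?_, ?_, ?_, ?_, ?_⟩ <;>
      simp [Prog.exec, IdxExpr.val, RealExpr.val, h0, h1, h2, h3, h4]
  · simp only [Test.cost, IdxExpr.cost]
    omega

lemma initState_mem_zero {n d : ℕ} (x : Fin n → EuclideanSpace ℝ (Fin d)) (j : Fin n)
    (i : Fin d) : (initState x).mem 0 (j * d + i) = x j i := by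
  have hd : 0 < d := i.pos
  have h1 : ((j : ℕ) * d + i) / d = j := by
    rw [mul_comm, Nat.mul_add_div hd, Nat.div_eq_of_lt i.2, add_zero]
  have h2 : ((j : ℕ) * d + i) % d = i := by
    rw [mul_comm, Nat.mul_add_mod, Nat.mod_eq_of_lt i.2]
  simp [initState, h1, h2]

lemma trimmedMeanProg_spec {n d : ℕ} (hn : 1 ≤ n) (hd : 1 ≤ d)
    (x : Fin n → EuclideanSpace ℝ (Fin d)) :
    RunsTo trimmedMeanProg (initState x) (1400 * (n * d) * (Nat.clog 2 n + 1))
      fun s' => ∀ i : Fin d, s'.mem 1 i = RobustMean.coordTrimmedMean (1 / 3) x i := by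
  refine (RunsTo.whileLoop (N := d)
    (T := (100 * n + 100) + ((Nat.clog 2 n * (250 * n + 250) + 100) + ((100 * n + 100) + 20)))
    (I := fun i s => ∃ M₁, Ctx n d i ((initState x).mem 0) M₁ s ∧ ∀ l : Fin d, (l : ℕ) < i →
      M₁ l = RobustMean.coordTrimmedMean (1 / 3) x l) ?_ ?_ ?_).mono ?_ ?_
  · rintro i hi s ⟨M₁, hc, hM⟩
    refine ⟨by simp only [Test.holds, IdxExpr.val, hc.reg1, hc.reg2]; omega, ?_⟩
    refine (loadColumn_spec hc).seq fun s₁ ⟨hc₁, hload⟩ => (mergeSort_spec hc₁).seq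
      fun s₂ ⟨hc₂, hsorted, hperm⟩ => (weightedMean_spec hc₂).seq fun s₃ hc₃ =>
        .of_exec (by decide) (by decide) ?_
    have hval := RobustMean.coordTrimmedMean_third_eq_sum (y := s₂.mem 2) hn x ⟨i, hi⟩ hsorted
      fun f => by
        rw [hperm f, Finset.sum_range]
        refine Finset.sum_congr rfl fun j _ => ?_
        rw [hload j j.2, initState_mem_zero x j ⟨i, hi⟩]
    obtain ⟨h0, h1, h2, h3, h4⟩ := hc₃
    refine ⟨_, ⟨?_, ?_, ?_, ?_, rfl⟩, fun l hl => ?_⟩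
    case refine_5 =>
      simp only [Prog.exec, h4, ← hval]
      by_cases hli : (l : ℕ) = i
      · obtain rfl : l = ⟨i, hi⟩ := Fin.ext hli
        simp
      · rw [Function.update_of_ne hli, hM l (by omega)]
    all_goals simp [Prog.exec, IdxExpr.val, *]
  · rintro s ⟨M₁, hc, -⟩
    simp only [Test.holds, IdxExpr.val, hc.reg1, hc.reg2]
    omega
  · exact ⟨_, ⟨rfl, rfl, rfl, rfl, rfl⟩, fun l hl => absurd hl (Nat.not_lt_zero _)⟩
  · simp only [Test.cost, IdxExpr.cost]
    -- Since `n, d ≥ 1`, all lower-order terms are absorbed into multiples of `n * d`.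
    have h1 : 1 ≤ n * d := Nat.mul_pos hn hd
    have h2 : Nat.clog 2 n * d ≤ Nat.clog 2 n * (n * d) :=
      Nat.mul_le_mul_left _ (Nat.le_mul_of_pos_left d hn)
    have h3 : d ≤ n * d := Nat.le_mul_of_pos_left d hn
    nlinarith
  · rintro s ⟨M₁, hc, hM⟩ i
    rw [hc.mem1, hM i i.2]

/-! ### Running time in terms of natural logarithms -/

lemma clog_two_add_one_le (n : ℕ) :
    ((Nat.clog 2 n : ℝ) + 1) ≤ 2 * (1 + Real.log n) := by
  have hlog : 0 ≤ Real.log n := Real.log_natCast_nonneg n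
  rcases Nat.eq_zero_or_pos (Nat.clog 2 n) with h | h
  · rw [h]
    push_cast
    linarith
  · have hlt : 2 ^ (Nat.clog 2 n - 1) < n := (Nat.lt_clog_iff_pow_lt (by norm_num)).1 (by omega)
    have h1 : Real.log ((2 : ℝ) ^ (Nat.clog 2 n - 1)) ≤ Real.log n :=
      Real.log_le_log (by positivity) (by exact_mod_cast hlt.le)
    rw [Real.log_pow, Nat.cast_sub h, Nat.cast_one] at h1
    have h2 : (1 : ℝ) ≤ Nat.clog 2 n := by exact_mod_cast h
    -- Here `(Nat.clog 2 n - 1) * log 2 ≤ log n`, and `log 2 > 1/2` gives the factor `2`.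
    nlinarith [Real.log_two_gt_d9]

lemma ComputesWithin.mono {n d : ℕ} {c : Prog} {x : Fin n → EuclideanSpace ℝ (Fin d)}
    {z : EuclideanSpace ℝ (Fin d)} {T T' : ℝ} (h : ComputesWithin c x z T) (hT : T ≤ T') :
    ComputesWithin c x z T' := by
  obtain ⟨t, s', hr, ht, hz⟩ := h
  exact ⟨t, s', hr, ht.trans hT, hz⟩

theorem trimmedMeanProg_computesWithin {n d : ℕ} (hn : 1 ≤ n) (hd : 1 ≤ d)
    (x : Fin n → EuclideanSpace ℝ (Fin d)) :
    ComputesWithin trimmedMeanProg x (RobustMean.coordTrimmedMean (1 / 3) x)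
      (2800 * (n * d) * (1 + Real.log n)) := by
  obtain ⟨t, s', hr, ht, hz⟩ := trimmedMeanProg_spec hn hd x
  refine ⟨t, s', hr, ?_, hz⟩
  have ht' : (t : ℝ) ≤ 1400 * (n * d) * ((Nat.clog 2 n : ℝ) + 1) := by exact_mod_cast ht
  calc (t : ℝ) ≤ 1400 * (n * d) * ((Nat.clog 2 n : ℝ) + 1) := ht'
    _ ≤ 1400 * (n * d) * (2 * (1 + Real.log n)) := by
        gcongr
        exact clog_two_add_one_le n
    _ = _ := by ring

theorem trimmedMeanProg_computesWithin_of_le {n d A a : ℕ} (hn : 1 ≤ n) (hd : 1 ≤ d)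
    (h : (n : ℝ) ≤ A * (1 + Real.log d) ^ a) (x : Fin n → EuclideanSpace ℝ (Fin d)) :
    ComputesWithin trimmedMeanProg x (RobustMean.coordTrimmedMean (1 / 3) x)
      (2800 * A ^ 2 * d * (1 + Real.log d) ^ (2 * a)) := by
  refine (trimmedMeanProg_computesWithin hn hd x).mono ?_
  have hn0 : (0 : ℝ) < n := by exact_mod_cast hn
  -- This crude bound suffices: the cost becomes `n ^ 2 * d` up to a constant, whence `A ^ 2` and
  -- the exponent `2 * a`.
  have hlog : 1 + Real.log n ≤ n := by linarith [Real.log_le_sub_one_of_pos hn0]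
  calc 2800 * ((n : ℝ) * d) * (1 + Real.log n) ≤ 2800 * (n * d) * n := by gcongr
    _ = 2800 * d * (n : ℝ) ^ 2 := by ring
    _ ≤ 2800 * d * (A * (1 + Real.log d) ^ a) ^ 2 := by gcongr
    _ = _ := by ring

end RealRAM

theorem mainTheorem12 :
    (∃ c C : ℝ, 0 < c ∧ 0 < C ∧
      ∀ (n d : ℕ), 1 ≤ n → 1 ≤ d → c * Real.log d ≤ n →
      ∀ (Ω : Type*) [MeasurableSpace Ω] (P : Measure Ω)
        (𝒵 : Set (RobustMean.Space d)) (𝒢 : Set (Measure (RobustMean.Space d)))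
        (p ε ρ₀ : ℝ) (μ : Measure (RobustMean.Space d))
        (Z Z' : Fin n → Ω → RobustMean.Space d),
        RobustMean.CorruptedSample P 𝒵 𝒢 p ε ρ₀ μ Z Z' →
        𝒢 ⊆ RobustMean.boundedCov 𝒵 → ε ≤ 1 / 3 →
        0.99 ≤ P.real {ω | ‖RobustMean.coordTrimmedMean (1 / 3) (fun j => Z' j ω) - ∫ z, z ∂μ‖
          ≤ C * (Real.sqrt d + ρ₀)}) ∧
    (∃ prog : RealRAM.Prog,
      (∃ K : ℝ, ∀ (n d : ℕ), 1 ≤ n → 1 ≤ d → ∀ x : Fin n → RobustMean.Space d,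
        RealRAM.ComputesWithin prog x (RobustMean.coordTrimmedMean (1 / 3) x)
          (K * (n * d) * (1 + Real.log n))) ∧
      (∀ A a : ℕ, ∃ (K : ℝ) (k : ℕ), ∀ (n d : ℕ), 1 ≤ n → 1 ≤ d →
        (n : ℝ) ≤ A * (1 + Real.log d) ^ a → ∀ x : Fin n → RobustMean.Space d,
        RealRAM.ComputesWithin prog x (RobustMean.coordTrimmedMean (1 / 3) x)
          (K * d * (1 + Real.log d) ^ k))) := by
  refine ⟨⟨1, 303, one_pos, by norm_num, ?_⟩, RealRAM.trimmedMeanProg, ⟨2800, ?_⟩, ?_⟩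
  · intro n d hn hd _ Ω _ P 𝒵 𝒢 p ε ρ₀ μ Z Z' hS h𝒢 hε
    exact RobustMean.coordTrimmedMean_coarse hn hd hS h𝒢 hε
  · intro n d hn hd x
    exact RealRAM.trimmedMeanProg_computesWithin hn hd x
  · intro A a
    exact ⟨2800 * (A : ℝ) ^ 2, 2 * a, fun n d hn hd h x =>
      RealRAM.trimmedMeanProg_computesWithin_of_le hn hd h x⟩
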